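/- Throughout, for complex $q$ with $0<|q|<1$ put $(a;q)_k=\prod_{i=0}^{k-1}(1-aq^i)$ for integers $k\ge 0$, $(a;q)_\infty=\prod_{i=0}^{\infty}(1-aq^i)$, $(a_1,\dots,a_r;q)_k=(a_1;q)_k\cdots(a_r;q)_k$ for $0\le k\le\infty$, and $$\begin{bmatrix}a_1,\dots,a_r\\ \alpha_1,\dots,\alpha_t\end{bmatrix}_k=\frac{(a_1,\dots,a_r;q)_k}{(\alpha_1,\dots,\alpha_t;q)_k}.$$ **Theorem.** Let $n\ge 0$ be an integer, let $x,y,b,c,d$ be nonzero complex numbers, let $x_\iota,y_\iota\in\mathbb{C}$ and $N_\iota\in\mathbb{N}_0$ for $1\le\iota\le n$, and put $N=\sum_{\iota=1}^nN_\iota$. Assume $$\frac{xy^2}{x_\iota y_\iota}=q^{N_\iota}\quad(1\le\iota\le n),\qquad \left|\frac{bcd}{xy^2q^{N+1}}\right|<1,$$ and that no denominator in the identity below vanishes (in the multiple sum this is needed only for the terms with $m_\iota\le N_\iota$ for all $\iota$; all other terms are $0$). Then the two series on the left converge absolutely, the multiple sum on the right has only finitely many nonzero terms, and \begin{align*} 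&\sum_{k=0}^{\infty}\Big(1-\frac{q^{2k+1}}{x}\Big)\frac{\big(\frac{q}{xy},\frac{q^{-k}b}{y},\frac{q^{-k}c}{y},\frac{q^{-k}d}{y},\{\frac{q^{-k}x_\iota}{y},\frac{q^{-k}y_\iota}{y}\}_{\iota=1}^n;q\big)_k}{\big(y,\frac{b}{xy},\frac{c}{xy},\frac{d}{xy},\{\frac{x_\iota}{xy},\frac{y_\iota}{xy}\}_{\iota=1}^n;q\big)_{k+1}}\,q^{\frac{(2n+3)k^2+(2n+1)k}{2}}\Big(-\frac{y}{x^{n+1}}\Big)^k\\ &\quad-x^{n+1}\sum_{k=0}^{\infty}(1-q^{2k+1}x)\frac{\big(\frac{q}{y},\frac{q^{-k}b}{xy},\frac{q^{-k}c}{xy},\frac{q^{-k}d}{xy},\{\frac{q^{-k}x_\iota}{xy},\frac{q^{-k}y_\iota}{xy}\}_{\iota=1}^n;q\big)_k}{\big(xy,\frac{b}{y},\frac{c}{y},\frac{d}{y},\{\frac{x_\iota}{y},\frac{y_\iota}{y}\}_{\iota=1}^n;q\big)_{k+1}}\,q^{\frac{(2n+3)k^2+(2n+1)k}{2}}(-x^{n+2}y)^k\\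 &=(-xy)^n\begin{bmatrix}q,\,x,\,q/x,\,b,\,c,\,d,\,bc/xy^2,\,bd/xy^2,\,cd/xy^2\\ y,\,xy,\,b/y,\,c/y,\,d/y,\,b/xy,\,c/xy,\,d/xy,\,bcd/qxy^2\end{bmatrix}_\infty\prod_{\iota=1}^n\frac{1}{x_\iota}\begin{bmatrix}qy/x_\iota,\,qxy/x_\iota,\,y_\iota,\,qy_\iota/xy^2\\ q/x_\iota,\,xy^2/x_\iota,\,y_\iota/y,\,y_\iota/xy\end{bmatrix}_\infty\\ &\quad\times\sum_{(m_1,\dots,m_n)\in\mathbb{N}_0^n}\begin{bmatrix}x_ny_n/xy^2\\ q\end{bmatrix}_{m_n}\begin{bmatrix}q/b,\,q/c,\,q/d\\ qx_n/xy^2,\,qy_n/xy^2,\,q^2xy^2/bcd\end{bmatrix}_{M_n}q^{M_n}\\ &\qquad\qquad\times\prod_{s=1}^{n-1}\begin{bmatrix}x_sy_s/xy^2\\ q\end{bmatrix}_{m_s}\begin{bmatrix}q/x_{s+1},\,q/y_{s+1}\\ qx_s/xy^2,\,qy_s/xy^2\end{bmatrix}_{M_s}\Big(\frac{x_{s+1}y_{s+1}}{xy^2}\Big)^{M_s},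 \end{align*} where $M_s=m_1+\cdots+m_s$; in a quotient such as $bc/xy^2$ or $b/xy$ everything after the slash is in the denominator, and for $n=0$ the multiple sum is understood to be $1$. -/

import Mathlib

/-- The finite `q`-shifted factorial `(a; q)_k = ∏_{i=0}^{k-1} (1 - a q^i)`, for `k ≥ 0`. -/
noncomputable def qPoch (q a : ℂ) (k : ℕ) : ℂ :=
  ∏ i ∈ Finset.range k, (1 - a * q ^ i)

/-- The infinite `q`-shifted factorial `(a; q)_∞ = ∏_{i=0}^∞ (1 - a q^i)`; the product converges
unconditionally for every `a` when `‖q‖ < 1`. -/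
noncomputable def qPochInf (q a : ℂ) : ℂ :=
  ∏' i : ℕ, (1 - a * q ^ i)

/-- The compact notation `(a₁, …, a_r; q)_k = (a₁; q)_k ⋯ (a_r; q)_k`. -/
noncomputable def qPochs (q : ℂ) (l : List ℂ) (k : ℕ) : ℂ :=
  (l.map fun a => qPoch q a k).prod

/-- The compact notation `(a₁, …, a_r; q)_∞ = (a₁; q)_∞ ⋯ (a_r; q)_∞`. -/
noncomputable def qPochInfs (q : ℂ) (l : List ℂ) : ℂ :=
  (l.map fun a => qPochInf q a).prod

/-- The `k`-th term of the first series on the left-hand side. The number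
`(2n+3)k² + (2n+1)k` is even, so the division in the exponent of `q` is exact. -/
noncomputable def firstTerm {n : ℕ} (q x y b c d : ℂ) (X Y : Fin n → ℂ) (k : ℕ) : ℂ :=
  (1 - q ^ (2 * k + 1) / x)
    * ((qPochs q [q / (x * y), (q ^ k)⁻¹ * b / y, (q ^ k)⁻¹ * c / y, (q ^ k)⁻¹ * d / y] k
          * ∏ i, qPochs q [(q ^ k)⁻¹ * X i / y, (q ^ k)⁻¹ * Y i / y] k)
      / (qPochs q [y, b / (x * y), c / (x * y), d / (x * y)] (k + 1)
          * ∏ i, qPochs q [X i / (x * y), Y i / (x * y)] (k + 1)))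
    * q ^ (((2 * n + 3) * k ^ 2 + (2 * n + 1) * k) / 2)
    * (-y / x ^ (n + 1)) ^ k

/-- The `k`-th term of the second series on the left-hand side, without the factor `x^{n+1}`
in front of that series. -/
noncomputable def secondTerm {n : ℕ} (q x y b c d : ℂ) (X Y : Fin n → ℂ) (k : ℕ) : ℂ :=
  (1 - q ^ (2 * k + 1) * x)
    * ((qPochs q [q / y, (q ^ k)⁻¹ * b / (x * y), (q ^ k)⁻¹ * c / (x * y),
            (q ^ k)⁻¹ * d / (x * y)] k
          * ∏ i, qPochs q [(q ^ k)⁻¹ * X i / (x * y), (q ^ k)⁻¹ * Y i / (x * y)] k)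
      / (qPochs q [x * y, b / y, c / y, d / y] (k + 1)
          * ∏ i, qPochs q [X i / y, Y i / y] (k + 1)))
    * q ^ (((2 * n + 3) * k ^ 2 + (2 * n + 1) * k) / 2)
    * (-x ^ (n + 2) * y) ^ k

/-- The partial sum `M_s = m_1 + ⋯ + m_s` (indices up to and including `s`). -/
def partialSum {n : ℕ} (m : Fin n → ℕ) (s : Fin n) : ℕ :=
  ∑ i ∈ Finset.Iic s, m i

/-- The summand of the multiple sum at `m = (m_1, …, m_n)`. The factor at `s` belongs to the
product over `1 ≤ s ≤ n - 1` when `s` has a successor in `Fin n`, and is the separate factor with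
index `n` when `s` is the last index. For `n = 0` the summand is `1`. -/
noncomputable def multiTerm {n : ℕ} (q x y b c d : ℂ) (X Y : Fin n → ℂ) (m : Fin n → ℕ) : ℂ :=
  ∏ s : Fin n,
    (qPoch q (X s * Y s / (x * y ^ 2)) (m s) / qPoch q q (m s))
      * (if h : s.val + 1 < n then
          qPochs q [q / X ⟨s.val + 1, h⟩, q / Y ⟨s.val + 1, h⟩] (partialSum m s)
            / qPochs q [q * X s / (x * y ^ 2), q * Y s / (x * y ^ 2)] (partialSum m s)
            * (X ⟨s.val + 1, h⟩ * Y ⟨s.val + 1, h⟩ / (x * y ^ 2)) ^ partialSum m s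
        else
          qPochs q [q / b, q / c, q / d] (partialSum m s)
            / qPochs q [q * X s / (x * y ^ 2), q * Y s / (x * y ^ 2),
                q ^ 2 * (x * y ^ 2) / (b * c * d)] (partialSum m s)
            * q ^ partialSum m s)

/-- The explicit product in front of the multiple sum. -/
noncomputable def prefactor {n : ℕ} (q x y b c d : ℂ) (X Y : Fin n → ℂ) : ℂ :=
  (-(x * y)) ^ n
    * (qPochInfs q [q, x, q / x, b, c, d,
          b * c / (x * y ^ 2), b * d / (x * y ^ 2), c * d / (x * y ^ 2)]
      / qPochInfs q [y, x * y, b / y, c / y, d / y, b / (x * y), c / (x * y), d / (x * y),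
          b * c * d / (q * (x * y ^ 2))])
    * ∏ i, (1 / X i)
        * (qPochInfs q [q * y / X i, q * (x * y) / X i, Y i, q * Y i / (x * y ^ 2)]
          / qPochInfs q [q / X i, x * y ^ 2 / X i, Y i / y, Y i / (x * y)])

open Filter Topology

/-! The two series are the two halves of one bilateral series. Since `Y i` equals `x y² q^{-N i} / X
i`, the quotient of factorials belonging to each pair collapses to a product of two finite
factorials of the fixed length `N i`. Up to the constant `bilateralConst`, the first series then
consists of the terms `k ≥ 0` of `psiSummand`, a very well-poised ₆ψ₆ term times these polynomial
factors (`firstTerm_eq`). The substitution `x → 1/x`, `y → xy` carries the first series to the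
second, and on `psiSummand` it amounts to `k → -(k+1)` up to the factor `-x` (`psiSummand_neg`). So
the left-hand side is `bilateralConst` times a sum over ℤ.

That sum is evaluated by induction on `n` (`hasSum_psiSummand`). For `n = 0` it is Bailey's ₆ψ₆ sum.
Otherwise the polynomial factor of the first pair is expanded by the `q`-Pfaff–Saalschütz identity
(`qPoch_mul_expand`) in products `(v, w; q)_j` with `v = q^{-k}/y` and `w = q^{k+1}/(xy)`. As `v w`
is free of `k`, so are the coefficients, and multiplication by `(v, w; q)_j` merely replaces `y` by
`y q^{-j}` in the ₆ψ₆ term, up to a factor free of `k`. What remains is the same problem with one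
pair fewer and with `y, b, c, d, X, Y` all multiplied by `q^{-j}`. The multiple sum obeys the same
recursion in `m_1 = j` (`multiTerm_cons`), and `psiConst_mul_multiHead` matches the constants. Each
such step multiplies the ₆ψ₆ argument `bcd/(q x y²)` by `q^{-j}` with `j` at most the current `N i`;
hence the power `q^{N+1}` in the convergence condition.

Bailey's sum is proved with all denominators cleared. A telescoping certificate relates the sums at
`b₀` and `q b₀`. Iteration and dominated convergence send `b₀` to `0`, and then the other parameters
likewise. The remaining sum depends on `a` and `q` only, and it is read off from a choice of
parameters for which only the term `k = 0` survives. -/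

/-! ### Finite and infinite `q`-shifted factorials. -/

theorem qPoch_zero (q a : ℂ) : qPoch q a 0 = 1 := by simp [qPoch]

theorem qPoch_succ (q a : ℂ) (k : ℕ) : qPoch q a (k + 1) = qPoch q a k * (1 - a * q ^ k) := by
  simp [qPoch, Finset.prod_range_succ]

theorem qPoch_add (q a : ℂ) (k l : ℕ) :
    qPoch q a (k + l) = qPoch q a k * qPoch q (a * q ^ k) l := by
  simp only [qPoch, Finset.prod_range_add, pow_add, mul_assoc]

theorem qPoch_succ' (q a : ℂ) (k : ℕ) : qPoch q a (k + 1) = (1 - a) * qPoch q (a * q) k := by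
  rw [add_comm, qPoch_add]; simp [qPoch]

theorem qPoch_ne_zero {q a : ℂ} {k : ℕ} (h : ∀ j < k, 1 - a * q ^ j ≠ 0) : qPoch q a k ≠ 0 :=
  Finset.prod_ne_zero_iff.2 fun j hj => h j (Finset.mem_range.1 hj)

theorem qPoch_self_ne_zero {q : ℂ} (hq1 : ‖q‖ < 1) (k : ℕ) : qPoch q q k ≠ 0 := by
  refine qPoch_ne_zero fun j _ h => ?_
  have h1 : q ^ (j + 1) = 1 := by rw [pow_succ']; exact (sub_eq_zero.1 h).symm
  have h2 : ‖q‖ ^ (j + 1) = 1 := by rw [← norm_pow, h1, norm_one]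
  exact (pow_lt_one₀ (norm_nonneg q) hq1 (Nat.succ_ne_zero j)).ne h2

/-- Reversal of the factors of a finite `q`-shifted factorial. -/
theorem qPoch_reflect {q a : ℂ} (hq : q ≠ 0) (ha : a ≠ 0) (k : ℕ) :
    qPoch q (a * (q ^ k)⁻¹) k * q ^ (k * (k + 1) / 2) = (-a) ^ k * qPoch q (q / a) k := by
  induction k with
  | zero => simp [qPoch]
  | succ k ih =>
    have e : (k + 1) * (k + 1 + 1) / 2 = k * (k + 1) / 2 + (k + 1) := by
      rw [← Nat.add_mul_div_right _ _ two_pos]; congr 1; ring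
    have e2 : a * (q ^ (k + 1))⁻¹ * q = a * (q ^ k)⁻¹ := by rw [pow_succ]; field_simp
    rw [qPoch_succ', e2, e, pow_add q (k * (k + 1) / 2), qPoch_succ, pow_succ (-a)]
    have e3 : (1 - a * (q ^ (k + 1))⁻¹) * q ^ (k + 1) = (-a) * (1 - q / a * q ^ k) := by
      field_simp; ring
    calc _ = (qPoch q (a * (q ^ k)⁻¹) k * q ^ (k * (k + 1) / 2))
          * ((1 - a * (q ^ (k + 1))⁻¹) * q ^ (k + 1)) := by ring
      _ = _ := by rw [ih, e3]; ring

theorem summable_norm_mul_pow {q : ℂ} (hq1 : ‖q‖ < 1) (a : ℂ) :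
    Summable fun i : ℕ => ‖-(a * q ^ i)‖ := by
  simpa using (summable_geometric_of_lt_one (norm_nonneg q) hq1).mul_left ‖a‖

theorem multipliable_qPoch {q : ℂ} (hq1 : ‖q‖ < 1) (a : ℂ) :
    Multipliable fun i : ℕ => 1 - a * q ^ i := by
  simpa [sub_eq_add_neg] using multipliable_one_add_of_summable (summable_norm_mul_pow hq1 a)

theorem tendsto_qPoch {q : ℂ} (hq1 : ‖q‖ < 1) (a : ℂ) :
    Tendsto (qPoch q a) atTop (𝓝 (qPochInf q a)) :=
  (multipliable_qPoch hq1 a).hasProd.tendsto_prod_nat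

theorem qPochInf_eq_mul {q : ℂ} (hq1 : ‖q‖ < 1) (a : ℂ) (k : ℕ) :
    qPochInf q a = qPoch q a k * qPochInf q (a * q ^ k) := by
  refine tendsto_nhds_unique ((tendsto_add_atTop_iff_nat k).2 (tendsto_qPoch hq1 a)) ?_
  have := (tendsto_qPoch hq1 (a * q ^ k)).const_mul (qPoch q a k)
  refine this.congr fun l => ?_
  rw [← qPoch_add, add_comm]

theorem qPochInf_one_sub {q : ℂ} (hq1 : ‖q‖ < 1) (a : ℂ) :
    qPochInf q a = (1 - a) * qPochInf q (a * q) := by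
  simpa [qPoch] using qPochInf_eq_mul hq1 a 1

theorem qPochInf_zero (q : ℂ) : qPochInf q 0 = 1 := by simp [qPochInf]

theorem qPochInf_ne_zero {q a : ℂ} (hq1 : ‖q‖ < 1) (h : ∀ j : ℕ, 1 - a * q ^ j ≠ 0) :
    qPochInf q a ≠ 0 := by
  have := tprod_one_add_ne_zero_of_summable (f := fun i : ℕ => -(a * q ^ i))
    (by simpa [sub_eq_add_neg] using h) (summable_norm_mul_pow hq1 a)
  simpa [qPochInf, sub_eq_add_neg] using this

theorem qPochInf_ne_zero_of_norm_lt {q a : ℂ} (hq1 : ‖q‖ < 1) (h : ‖a‖ < 1) :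
    qPochInf q a ≠ 0 := by
  refine qPochInf_ne_zero hq1 fun j hj => ?_
  have h1 : ‖a‖ * ‖q‖ ^ j = 1 := by
    rw [← norm_pow, ← norm_mul, ← sub_eq_zero.1 hj, norm_one]
  have : ‖a‖ * ‖q‖ ^ j ≤ ‖a‖ := mul_le_of_le_one_right (norm_nonneg _)
    (pow_le_one₀ (norm_nonneg q) hq1.le)
  linarith

theorem qPochInf_self_ne_zero {q : ℂ} (hq1 : ‖q‖ < 1) : qPochInf q q ≠ 0 :=
  qPochInf_ne_zero_of_norm_lt hq1 hq1

theorem qPochInf_eq_zero {q a : ℂ} (hq1 : ‖q‖ < 1) (j : ℕ) (h : a * q ^ j = 1) :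
    qPochInf q a = 0 := by
  rw [qPochInf_eq_mul hq1 a (j + 1), qPoch_succ, h]; simp

theorem norm_qPochInf_sub_one_le {q : ℂ} (hq1 : ‖q‖ < 1) (a : ℂ) :
    ‖qPochInf q a - 1‖ ≤ Real.exp (‖a‖ * (1 - ‖q‖)⁻¹) - 1 := by
  refine le_of_tendsto ((tendsto_qPoch hq1 a).sub_const 1).norm (Eventually.of_forall fun k => ?_)
  have := Finset.norm_prod_one_add_sub_one_le (Finset.range k) fun i => -(a * q ^ i)
  simp only [← sub_eq_add_neg] at this
  refine this.trans (sub_le_sub_right (Real.exp_le_exp.2 ?_) 1)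
  have h2 := (summable_norm_mul_pow hq1 a).sum_le_tsum (Finset.range k) (fun _ _ => norm_nonneg _)
  refine h2.trans (le_of_eq ?_)
  simp [tsum_mul_left, tsum_geometric_of_lt_one (norm_nonneg q) hq1]

theorem norm_qPochInf_le {q : ℂ} (hq1 : ‖q‖ < 1) (a : ℂ) :
    ‖qPochInf q a‖ ≤ Real.exp (‖a‖ * (1 - ‖q‖)⁻¹) := by
  have h1 := norm_qPochInf_sub_one_le hq1 a
  have h2 := norm_sub_norm_le (qPochInf q a) 1
  rw [norm_one] at h2
  linarith

theorem tendsto_qPochInf_mul_pow {q : ℂ} (hq1 : ‖q‖ < 1) (a : ℂ) :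
    Tendsto (fun m : ℕ => qPochInf q (a * q ^ m)) atTop (𝓝 1) := by
  rw [tendsto_iff_norm_sub_tendsto_zero]
  refine squeeze_zero (fun _ => norm_nonneg _) (fun m => norm_qPochInf_sub_one_le hq1 _) ?_
  have h : Tendsto (fun m : ℕ => ‖a * q ^ m‖) atTop (𝓝 0) := by
    have := (tendsto_pow_atTop_nhds_zero_of_lt_one (norm_nonneg q) hq1).const_mul ‖a‖
    simpa using this
  have := (Real.continuous_exp.tendsto _).comp (h.mul_const (1 - ‖q‖)⁻¹)
  simpa using this.sub_const 1

/-- Growth of `(b q^{-k}; q)_∞` in `k`, uniformly for `b` in a disc. -/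
theorem exists_norm_qPochInf_le {q : ℂ} (hq : q ≠ 0) (hq1 : ‖q‖ < 1) {R : ℝ} (hR : 0 < R) :
    ∃ C, 0 ≤ C ∧ ∀ b : ℂ, ‖b‖ ≤ R → ∀ k : ℕ,
      ‖qPochInf q (b * (q ^ k)⁻¹)‖ * ‖q‖ ^ (k * (k + 1) / 2) ≤ C * R ^ k := by
  have hr : 0 < ‖q‖ := norm_pos_iff.2 hq
  have key : ∀ b : ℂ, ‖b‖ ≤ R → ∀ k : ℕ, ‖qPochInf q (b * (q ^ k)⁻¹)‖ * ‖q‖ ^ (k * (k + 1) / 2)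
      ≤ Real.exp (R * (1 - ‖q‖)⁻¹) * Real.exp (∑ i ∈ Finset.range k, ‖q‖ ^ (i + 1) / R) * R ^ k := by
    intro b hb k
    induction k with
    | zero =>
      simp only [pow_zero, inv_one, mul_one, zero_mul, Nat.zero_div, Finset.range_zero,
        Finset.sum_empty, Real.exp_zero]
      refine (norm_qPochInf_le hq1 b).trans (Real.exp_le_exp.2 ?_)
      exact mul_le_mul_of_nonneg_right hb (inv_nonneg.2 (by linarith))
    | succ k ih =>
      have e : (k + 1) * (k + 1 + 1) / 2 = k * (k + 1) / 2 + (k + 1) := by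
        rw [← Nat.add_mul_div_right _ _ two_pos]; congr 1; ring
      have e2 : b * (q ^ (k + 1))⁻¹ * q = b * (q ^ k)⁻¹ := by rw [pow_succ]; field_simp
      have h3 : ‖1 - b * (q ^ (k + 1))⁻¹‖ * ‖q‖ ^ (k + 1)
          ≤ Real.exp (‖q‖ ^ (k + 1) / R) * R := by
        have : ‖1 - b * (q ^ (k + 1))⁻¹‖ ≤ 1 + R * (‖q‖ ^ (k + 1))⁻¹ := by
          refine (norm_sub_le _ _).trans ?_
          rw [norm_one, norm_mul, norm_inv, norm_pow]
          gcongr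
        calc _ ≤ (1 + R * (‖q‖ ^ (k + 1))⁻¹) * ‖q‖ ^ (k + 1) := by gcongr
          _ = (‖q‖ ^ (k + 1) / R + 1) * R := by field_simp
          _ ≤ _ := by gcongr; exact Real.add_one_le_exp _
      rw [qPochInf_one_sub hq1, e2, e, pow_add ‖q‖ (k * (k + 1) / 2), Finset.sum_range_succ,
        Real.exp_add, norm_mul, pow_succ R]
      calc _ = (‖qPochInf q (b * (q ^ k)⁻¹)‖ * ‖q‖ ^ (k * (k + 1) / 2))
            * (‖1 - b * (q ^ (k + 1))⁻¹‖ * ‖q‖ ^ (k + 1)) := by ring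
        _ ≤ _ := mul_le_mul ih h3 (by positivity) (by positivity)
        _ = _ := by ring
  refine ⟨Real.exp (R * (1 - ‖q‖)⁻¹) * Real.exp ((1 - ‖q‖)⁻¹ / R), by positivity,
    fun b hb k => (key b hb k).trans ?_⟩
  gcongr
  rw [← Finset.sum_div]
  gcongr
  rw [← tsum_geometric_of_lt_one hr.le hq1]
  calc ∑ i ∈ Finset.range k, ‖q‖ ^ (i + 1) ≤ ∑ i ∈ Finset.range k, ‖q‖ ^ i :=
        Finset.sum_le_sum fun i _ => pow_le_pow_of_le_one hr.le hq1.le (Nat.le_succ i)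
    _ ≤ _ := (summable_geometric_of_lt_one hr.le hq1).sum_le_tsum _ (fun _ _ => by positivity)

/-! ### The ₆ψ₆ summand: contiguous relation and reflection. -/

/-- The summand of Bailey's very well-poised `₆ψ₆` series with parameter `a`, written without
denominators. -/
noncomputable def psiTerm (q a b₀ b₁ b₂ b₃ : ℂ) (k : ℤ) : ℂ :=
  (1 - a * q ^ (2 * k)) * (a ^ (2 * k) * q ^ (2 * k ^ 2 - k))
    * ((qPochInf q (b₀ * q ^ (-k)) * qPochInf q (a * b₀ * q ^ k))
      * (qPochInf q (b₁ * q ^ (-k)) * qPochInf q (a * b₁ * q ^ k))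
      * (qPochInf q (b₂ * q ^ (-k)) * qPochInf q (a * b₂ * q ^ k))
      * (qPochInf q (b₃ * q ^ (-k)) * qPochInf q (a * b₃ * q ^ k)))

/-- The antidifference certifying the contiguous relation of `psiTerm` in `b₀`. -/
noncomputable def psiCert (q a b₀ b₁ b₂ b₃ : ℂ) (k : ℤ) : ℂ :=
  b₀ * (a ^ (2 * k) * q ^ (2 * k ^ 2 - 2 * k))
    * ((qPochInf q (b₀ * q ^ (1 - k)) * qPochInf q (a * b₀ * q ^ k))
      * (qPochInf q (b₁ * q ^ (-k)) * qPochInf q (a * b₁ * q ^ (k - 1)))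
      * (qPochInf q (b₂ * q ^ (-k)) * qPochInf q (a * b₂ * q ^ (k - 1)))
      * (qPochInf q (b₃ * q ^ (-k)) * qPochInf q (a * b₃ * q ^ (k - 1))))

/-- Every infinite product here is a few linear factors times one of eight common products, so the
relation reduces to the rational identity `key` in `q ^ k`. The `bᵢ` are `q` divided by the
classical ₆ψ₆ parameters; nothing is divided by them, so the value `0` is allowed. -/
theorem psiTerm_contiguous {q a : ℂ} (hq : q ≠ 0) (hq1 : ‖q‖ < 1) (ha : a ≠ 0)
    (b₀ b₁ b₂ b₃ : ℂ) (k : ℤ) :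
    (1 - a ^ 2 * (b₀ * b₁ * b₂ * b₃) / q ^ 3) * psiTerm q a b₀ b₁ b₂ b₃ k
      - (1 - a * b₀ * b₁ / q) * (1 - a * b₀ * b₂ / q) * (1 - a * b₀ * b₃ / q)
        * psiTerm q a (q * b₀) b₁ b₂ b₃ k
      = psiCert q a b₀ b₁ b₂ b₃ (k + 1) - psiCert q a b₀ b₁ b₂ b₃ k := by
  have hu : q ^ k ≠ 0 := zpow_ne_zero k hq
  have z1 : q ^ (-k) = (q ^ k)⁻¹ := zpow_neg q k
  have z2 : q ^ (2 * k) = (q ^ k) ^ 2 := by rw [mul_comm, zpow_mul]; norm_cast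
  have z3 : q ^ (1 - k) = q * (q ^ k)⁻¹ := by rw [zpow_sub₀ hq, zpow_one]; rfl
  have z4 : q ^ (k - 1) = q ^ k * q⁻¹ := by rw [zpow_sub₀ hq, zpow_one]; rfl
  have z5 : q ^ (-(k + 1)) = (q ^ k)⁻¹ * q⁻¹ := by
    rw [zpow_neg, zpow_add₀ hq, zpow_one, mul_inv]
  have z6 : q ^ (1 - (k + 1)) = (q ^ k)⁻¹ := by rw [← z1]; congr 1; ring
  have z7 : q ^ (k + 1) = q ^ k * q := by rw [zpow_add₀ hq, zpow_one]
  have z8 : q ^ (k + 1 - 1) = q ^ k := by congr 1; ring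
  have z9 : a ^ (2 * (k + 1)) = a ^ (2 * k) * a ^ 2 := by
    rw [mul_add, zpow_add₀ ha]; norm_cast
  have z10 : q ^ (2 * (k + 1) ^ 2 - 2 * (k + 1)) = q ^ (2 * k ^ 2 - k) * (q ^ k) ^ 3 := by
    have : (q ^ k) ^ 3 = q ^ (k * 3) := by rw [zpow_mul]; norm_cast
    rw [this, ← zpow_add₀ hq]; congr 1; ring
  have z11 : q ^ (2 * k ^ 2 - 2 * k) = q ^ (2 * k ^ 2 - k) * (q ^ k)⁻¹ := by
    rw [← z1, ← zpow_add₀ hq]; congr 1; ring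
  simp only [psiTerm, psiCert, z1, z2, z3, z4, z5, z6, z7, z8, z9, z10, z11]
  generalize q ^ (2 * k ^ 2 - k) = w
  generalize a ^ (2 * k) = v
  generalize q ^ k = u at *
  have s0 : qPochInf q (b₀ * u⁻¹) = (1 - b₀ * u⁻¹) * qPochInf q (b₀ * (q * u⁻¹)) := by
    rw [qPochInf_one_sub hq1]; congr 2; ring
  have s1 : qPochInf q (a * b₀ * u) = (1 - a * b₀ * u) * qPochInf q (a * b₀ * (u * q)) := by
    rw [qPochInf_one_sub hq1]; congr 2; ring
  have s2 : q * b₀ * u⁻¹ = b₀ * (q * u⁻¹) := by ring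
  have s3 : a * (q * b₀) * u = a * b₀ * (u * q) := by ring
  have t1 : ∀ b, qPochInf q (b * (u⁻¹ * q⁻¹)) = (1 - b * (u⁻¹ * q⁻¹)) * qPochInf q (b * u⁻¹) := by
    intro b
    rw [qPochInf_one_sub hq1]; congr 2; field_simp
  have t2 : ∀ b, qPochInf q (a * b * (u * q⁻¹))
      = (1 - a * b * (u * q⁻¹)) * qPochInf q (a * b * u) := by
    intro b
    rw [qPochInf_one_sub hq1]; congr 2; field_simp
  rw [s2, s3, s0, s1, t1 b₁, t1 b₂, t1 b₃, t2 b₁, t2 b₂, t2 b₃]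
  generalize qPochInf q (b₀ * (q * u⁻¹)) = p₀
  generalize qPochInf q (a * b₀ * (u * q)) = p₁
  generalize qPochInf q (b₁ * u⁻¹) = p₂
  generalize qPochInf q (a * b₁ * u) = p₃
  generalize qPochInf q (b₂ * u⁻¹) = p₄
  generalize qPochInf q (a * b₂ * u) = p₅
  generalize qPochInf q (b₃ * u⁻¹) = p₆
  generalize qPochInf q (a * b₃ * u) = p₇
  have key : (1 - a * u ^ 2) * ((1 - a ^ 2 * (b₀ * b₁ * b₂ * b₃) / q ^ 3)
        * ((1 - b₀ * u⁻¹) * (1 - a * b₀ * u))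
        - (1 - a * b₀ * b₁ / q) * (1 - a * b₀ * b₂ / q) * (1 - a * b₀ * b₃ / q))
      = b₀ * (a ^ 2 * u ^ 3 * ((1 - b₀ * u⁻¹) * (1 - b₁ * (u⁻¹ * q⁻¹)) * (1 - b₂ * (u⁻¹ * q⁻¹))
          * (1 - b₃ * (u⁻¹ * q⁻¹)))
        - u⁻¹ * ((1 - a * b₀ * u) * (1 - a * b₁ * (u * q⁻¹)) * (1 - a * b₂ * (u * q⁻¹))
          * (1 - a * b₃ * (u * q⁻¹)))) := by
    field_simp
    ring
  linear_combination v * w * p₀ * p₁ * p₂ * p₃ * p₄ * p₅ * p₆ * p₇ * key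

/-- Reversing the direction of summation preserves the very well-poised form, so results for `k ≥ 0`
also cover the negative half. The offset in `-(j + 1)` makes the two halves cover ℤ exactly once. -/
theorem psiTerm_neg {q a : ℂ} (hq : q ≠ 0) (ha : a ≠ 0) (b₀ b₁ b₂ b₃ : ℂ) (j : ℤ) :
    psiTerm q a b₀ b₁ b₂ b₃ (-(j + 1)) = -(q / a)
      * psiTerm q (q ^ 2 / a) (a * b₀ / q) (a * b₁ / q) (a * b₂ / q) (a * b₃ / q) j := by
  have hu : q ^ j ≠ 0 := zpow_ne_zero j hq
  have z1 : q ^ (-j) = (q ^ j)⁻¹ := zpow_neg q j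
  have z2 : q ^ (2 * j) = (q ^ j) ^ 2 := by rw [mul_comm, zpow_mul]; norm_cast
  have z4 : q ^ (-(j + 1)) = (q ^ j)⁻¹ * q⁻¹ := by rw [zpow_neg, zpow_add₀ hq, zpow_one, mul_inv]
  have z5 : q ^ (- -(j + 1)) = q ^ j * q := by rw [neg_neg, zpow_add₀ hq, zpow_one]
  have z6 : q ^ (2 * -(j + 1)) = ((q ^ j)⁻¹ * q⁻¹) ^ 2 := by
    rw [← z4, mul_comm, zpow_mul]; norm_cast
  have z7 : a ^ (2 * -(j + 1)) = (a ^ (2 * j))⁻¹ * (a ^ 2)⁻¹ := by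
    rw [show 2 * -(j + 1) = -(2 * j) + -2 by ring, zpow_add₀ ha, zpow_neg, zpow_neg]; norm_cast
  have z8 : q ^ (2 * (-(j + 1)) ^ 2 - -(j + 1)) = q ^ (2 * j ^ 2 - j) * (q ^ j) ^ 6 * q ^ 3 := by
    have : (q ^ j) ^ 6 = q ^ (j * 6) := by rw [zpow_mul]; norm_cast
    rw [this, ← zpow_natCast q 3, ← zpow_add₀ hq, ← zpow_add₀ hq]; congr 1; push_cast; ring
  have z9 : (q ^ 2 / a) ^ (2 * j) = (q ^ j) ^ 4 * (a ^ (2 * j))⁻¹ := by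
    have : (q ^ j) ^ 4 = q ^ (j * 4) := by rw [zpow_mul]; norm_cast
    rw [div_zpow, this, ← zpow_natCast q 2, ← zpow_mul, div_eq_mul_inv]; congr 2; push_cast; ring
  simp only [psiTerm, z1, z2, z4, z5, z6, z7, z8, z9]
  have e1 : ∀ b, qPochInf q (b * (q ^ j * q)) = qPochInf q (q ^ 2 / a * (a * b / q) * q ^ j) := by
    intro b; congr 1; field_simp
  have e2 : ∀ b, qPochInf q (a * b * ((q ^ j)⁻¹ * q⁻¹)) = qPochInf q (a * b / q * (q ^ j)⁻¹) := by
    intro b; congr 1; field_simp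
  simp only [e1, e2]
  have hv : a ^ (2 * j) ≠ 0 := zpow_ne_zero _ ha
  have key : (1 - a * ((q ^ j)⁻¹ * q⁻¹) ^ 2) * ((a ^ (2 * j))⁻¹ * (a ^ 2)⁻¹
        * (q ^ (2 * j ^ 2 - j) * (q ^ j) ^ 6 * q ^ 3))
      = -(q / a) * ((1 - q ^ 2 / a * (q ^ j) ^ 2) * ((q ^ j) ^ 4 * (a ^ (2 * j))⁻¹
        * q ^ (2 * j ^ 2 - j))) := by
    field_simp
    ring
  rw [key]
  ring

theorem psiCert_neg {q a : ℂ} (hq : q ≠ 0) (ha : a ≠ 0) (b₀ b₁ b₂ b₃ : ℂ) (j : ℤ) :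
    psiCert q a b₀ b₁ b₂ b₃ (-j) = q / a
      * psiCert q (q ^ 2 / a) (a * b₀ / q) (a * b₁ / q) (a * b₂ / q) (a * b₃ / q) j := by
  have hu : q ^ j ≠ 0 := zpow_ne_zero j hq
  have z1 : q ^ (-j) = (q ^ j)⁻¹ := zpow_neg q j
  have z3 : q ^ (1 - j) = q * (q ^ j)⁻¹ := by rw [zpow_sub₀ hq, zpow_one]; rfl
  have z4 : q ^ (j - 1) = q ^ j * q⁻¹ := by rw [zpow_sub₀ hq, zpow_one]; rfl
  have z5 : q ^ (1 - -j) = q * q ^ j := by rw [sub_neg_eq_add, zpow_add₀ hq, zpow_one]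
  have z6 : q ^ (-j - 1) = (q ^ j)⁻¹ * q⁻¹ := by rw [zpow_sub₀ hq, zpow_one, z1]; rfl
  have z7 : a ^ (2 * -j) = (a ^ (2 * j))⁻¹ := by rw [← zpow_neg]; congr 1; ring
  have z8 : q ^ (2 * (-j) ^ 2 - 2 * -j) = q ^ (2 * j ^ 2 - 2 * j) * (q ^ j) ^ 4 := by
    have : (q ^ j) ^ 4 = q ^ (j * 4) := by rw [zpow_mul]; norm_cast
    rw [this, ← zpow_add₀ hq]; congr 1; ring
  have z9 : (q ^ 2 / a) ^ (2 * j) = (q ^ j) ^ 4 * (a ^ (2 * j))⁻¹ := by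
    have : (q ^ j) ^ 4 = q ^ (j * 4) := by rw [zpow_mul]; norm_cast
    rw [div_zpow, this, ← zpow_natCast q 2, ← zpow_mul, div_eq_mul_inv]; congr 2; push_cast; ring
  simp only [psiCert, neg_neg, z1, z3, z4, z5, z6, z7, z8, z9]
  have e1 : qPochInf q (b₀ * (q * q ^ j)) = qPochInf q (q ^ 2 / a * (a * b₀ / q) * q ^ j) := by
    congr 1; field_simp
  have e2 : qPochInf q (a * b₀ * (q ^ j)⁻¹) = qPochInf q (a * b₀ / q * (q * (q ^ j)⁻¹)) := by
    congr 1; field_simp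
  have e3 : ∀ b, qPochInf q (b * q ^ j)
      = qPochInf q (q ^ 2 / a * (a * b / q) * (q ^ j * q⁻¹)) := by
    intro b; congr 1; field_simp
  have e4 : ∀ b, qPochInf q (a * b * ((q ^ j)⁻¹ * q⁻¹)) = qPochInf q (a * b / q * (q ^ j)⁻¹) := by
    intro b; congr 1; field_simp
  rw [e1, e2, e3 b₁, e3 b₂, e3 b₃, e4 b₁, e4 b₂, e4 b₃]
  have : q / a * (a * b₀ / q) = b₀ := by field_simp
  linear_combination -(qPochInf q (q ^ 2 / a * (a * b₀ / q) * q ^ j)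
    * qPochInf q (a * b₀ / q * (q * (q ^ j)⁻¹))
    * (qPochInf q (q ^ 2 / a * (a * b₁ / q) * (q ^ j * q⁻¹)) * qPochInf q (a * b₁ / q * (q ^ j)⁻¹))
    * (qPochInf q (q ^ 2 / a * (a * b₂ / q) * (q ^ j * q⁻¹)) * qPochInf q (a * b₂ / q * (q ^ j)⁻¹))
    * (qPochInf q (q ^ 2 / a * (a * b₃ / q) * (q ^ j * q⁻¹)) * qPochInf q (a * b₃ / q * (q ^ j)⁻¹))
    * ((a ^ (2 * j))⁻¹ * (q ^ (2 * j ^ 2 - 2 * j) * (q ^ j) ^ 4))) * this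

/-! ### Growth estimates, convergence, and the limit `b₀ → 0`. -/

theorem exists_norm_pair_le {q : ℂ} (hq : q ≠ 0) (hq1 : ‖q‖ < 1) (a : ℂ) {R : ℝ} (hR : 0 < R) :
    ∃ C, 0 ≤ C ∧ ∀ b : ℂ, ‖b‖ ≤ R → ∀ k : ℕ,
      ‖qPochInf q (b * q ^ (-(k : ℤ))) * qPochInf q (a * b * q ^ (k : ℤ))‖
        * ‖q‖ ^ (k * (k + 1) / 2) ≤ C * R ^ k := by
  obtain ⟨C, hC, h⟩ := exists_norm_qPochInf_le hq hq1 hR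
  refine ⟨C * Real.exp (‖a‖ * R * (1 - ‖q‖)⁻¹), by positivity, fun b hb k => ?_⟩
  have h1 : ‖qPochInf q (a * b * q ^ (k : ℤ))‖ ≤ Real.exp (‖a‖ * R * (1 - ‖q‖)⁻¹) := by
    refine (norm_qPochInf_le hq1 _).trans (Real.exp_le_exp.2 ?_)
    have : 0 ≤ (1 - ‖q‖)⁻¹ := inv_nonneg.2 (by linarith)
    refine mul_le_mul_of_nonneg_right ?_ this
    rw [zpow_natCast, norm_mul, norm_mul, norm_pow]
    calc _ ≤ ‖a‖ * ‖b‖ := mul_le_of_le_one_right (by positivity)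
          (pow_le_one₀ (norm_nonneg q) hq1.le)
      _ ≤ _ := by gcongr
  have h2 := h b hb k
  rw [zpow_neg, zpow_natCast, norm_mul]
  rw [zpow_natCast] at h1
  calc _ = (‖qPochInf q (b * (q ^ k)⁻¹)‖ * ‖q‖ ^ (k * (k + 1) / 2))
        * ‖qPochInf q (a * b * q ^ k)‖ := by ring
    _ ≤ (C * R ^ k) * Real.exp (‖a‖ * R * (1 - ‖q‖)⁻¹) := by gcongr
    _ = _ := by ring

theorem exists_norm_pairs_le {q : ℂ} (hq : q ≠ 0) (hq1 : ‖q‖ < 1) (a : ℂ) {R₀ R₁ R₂ R₃ : ℝ}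
    (h₀ : 0 < R₀) (h₁ : 0 < R₁) (h₂ : 0 < R₂) (h₃ : 0 < R₃) :
    ∃ C, 0 ≤ C ∧ ∀ b₀ b₁ b₂ b₃ : ℂ, ‖b₀‖ ≤ R₀ → ‖b₁‖ ≤ R₁ → ‖b₂‖ ≤ R₂ → ‖b₃‖ ≤ R₃ → ∀ k : ℕ,
      ‖(qPochInf q (b₀ * q ^ (-(k : ℤ))) * qPochInf q (a * b₀ * q ^ (k : ℤ)))
        * (qPochInf q (b₁ * q ^ (-(k : ℤ))) * qPochInf q (a * b₁ * q ^ (k : ℤ)))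
        * (qPochInf q (b₂ * q ^ (-(k : ℤ))) * qPochInf q (a * b₂ * q ^ (k : ℤ)))
        * (qPochInf q (b₃ * q ^ (-(k : ℤ))) * qPochInf q (a * b₃ * q ^ (k : ℤ)))‖
        * ‖q‖ ^ (2 * k * (k + 1)) ≤ C * (R₀ * R₁ * R₂ * R₃) ^ k := by
  obtain ⟨C₀, p₀, e₀⟩ := exists_norm_pair_le hq hq1 a h₀
  obtain ⟨C₁, p₁, e₁⟩ := exists_norm_pair_le hq hq1 a h₁
  obtain ⟨C₂, p₂, e₂⟩ := exists_norm_pair_le hq hq1 a h₂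
  obtain ⟨C₃, p₃, e₃⟩ := exists_norm_pair_le hq hq1 a h₃
  refine ⟨C₀ * C₁ * C₂ * C₃, by positivity, fun b₀ b₁ b₂ b₃ g₀ g₁ g₂ g₃ k => ?_⟩
  have f₀ := e₀ b₀ g₀ k
  have f₁ := e₁ b₁ g₁ k
  have f₂ := e₂ b₂ g₂ k
  have f₃ := e₃ b₃ g₃ k
  have e : ‖q‖ ^ (2 * k * (k + 1)) = (‖q‖ ^ (k * (k + 1) / 2)) ^ 4 := by
    rw [← pow_mul]; congr 1
    have := Nat.div_mul_cancel (Nat.even_mul_succ_self k).two_dvd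
    calc 2 * k * (k + 1) = 2 * (k * (k + 1)) := by ring
      _ = 2 * (k * (k + 1) / 2 * 2) := by rw [this]
      _ = _ := by ring
  rw [e, norm_mul, norm_mul, norm_mul (qPochInf q (b₀ * q ^ (-(k : ℤ))) * _)]
  have hn₁ := norm_nonneg (qPochInf q (b₁ * q ^ (-(k : ℤ))) * qPochInf q (a * b₁ * q ^ (k : ℤ)))
  generalize ‖qPochInf q (b₀ * q ^ (-(k : ℤ))) * qPochInf q (a * b₀ * q ^ (k : ℤ))‖ = n₀ at *
  generalize ‖qPochInf q (b₁ * q ^ (-(k : ℤ))) * qPochInf q (a * b₁ * q ^ (k : ℤ))‖ = n₁ at *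
  have hn₂ := norm_nonneg (qPochInf q (b₂ * q ^ (-(k : ℤ))) * qPochInf q (a * b₂ * q ^ (k : ℤ)))
  have hn₃ := norm_nonneg (qPochInf q (b₃ * q ^ (-(k : ℤ))) * qPochInf q (a * b₃ * q ^ (k : ℤ)))
  generalize ‖qPochInf q (b₂ * q ^ (-(k : ℤ))) * qPochInf q (a * b₂ * q ^ (k : ℤ))‖ = n₂ at *
  generalize ‖qPochInf q (b₃ * q ^ (-(k : ℤ))) * qPochInf q (a * b₃ * q ^ (k : ℤ))‖ = n₃ at *
  have hw : 0 < ‖q‖ ^ (k * (k + 1) / 2) := pow_pos (norm_pos_iff.2 hq) _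
  generalize ‖q‖ ^ (k * (k + 1) / 2) = w at *
  calc n₀ * n₁ * n₂ * n₃ * w ^ 4 = n₀ * w * (n₁ * w) * (n₂ * w) * (n₃ * w) := by ring
    _ ≤ (C₀ * R₀ ^ k) * (C₁ * R₁ ^ k) * (C₂ * R₂ ^ k) * (C₃ * R₃ ^ k) := by gcongr
    _ = _ := by ring

/-- The growth bounds need positive radii although a parameter may be `0`. The condition on the
argument is open, so all the norms can be enlarged a little. -/
theorem exists_radii {a q b₀ b₁ b₂ b₃ : ℂ} (h : ‖a ^ 2 * (b₀ * b₁ * b₂ * b₃) / q ^ 3‖ < 1) :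
    ∃ R₀ R₁ R₂ R₃ : ℝ, 0 < R₀ ∧ 0 < R₁ ∧ 0 < R₂ ∧ 0 < R₃ ∧ ‖b₀‖ ≤ R₀ ∧ ‖b₁‖ ≤ R₁ ∧ ‖b₂‖ ≤ R₂
      ∧ ‖b₃‖ ≤ R₃ ∧ ‖a‖ ^ 2 * (R₀ * R₁ * R₂ * R₃) / ‖q‖ ^ 3 < 1 := by
  have hc : Continuous fun ε : ℝ => ‖a‖ ^ 2 * ((‖b₀‖ + ε) * (‖b₁‖ + ε) * (‖b₂‖ + ε) * (‖b₃‖ + ε))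
      / ‖q‖ ^ 3 := by fun_prop
  have h0 : (fun ε : ℝ => ‖a‖ ^ 2 * ((‖b₀‖ + ε) * (‖b₁‖ + ε) * (‖b₂‖ + ε) * (‖b₃‖ + ε))
      / ‖q‖ ^ 3) 0 < 1 := by simpa using h
  have h1 := (hc.tendsto 0).eventually_lt_const h0
  have h2 : ∀ᶠ ε in 𝓝[>] (0 : ℝ), ‖a‖ ^ 2 * ((‖b₀‖ + ε) * (‖b₁‖ + ε) * (‖b₂‖ + ε) * (‖b₃‖ + ε))
      / ‖q‖ ^ 3 < 1 := h1.filter_mono nhdsWithin_le_nhds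
  obtain ⟨ε, hε, hε0⟩ := (h2.and self_mem_nhdsWithin).exists
  have hε0 : 0 < ε := hε0
  exact ⟨_, _, _, _, by positivity, by positivity, by positivity, by positivity,
    by linarith, by linarith, by linarith, by linarith, hε⟩

/-- The exponent `2k(k+1)` is four times `k(k+1)/2`, exactly what the growth of four pairs in
`exists_norm_pairs_le` consumes; the remainder is geometric in `k`. -/
theorem zpow_two_sq_sub {r : ℝ} (hr : 0 < r) (k : ℕ) (c : ℕ) :
    r ^ (2 * (k : ℤ) ^ 2 - c * k) = r ^ (2 * k * (k + 1)) * ((r ^ (c + 2))⁻¹) ^ k := by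
  rw [inv_pow, ← pow_mul, ← zpow_natCast, ← zpow_natCast, ← zpow_neg, ← zpow_add₀ hr.ne']
  congr 1
  push_cast
  ring

/-- The disc of radius `R₀` contains every `b₀ q^m`, so one geometric series dominates for all `m`;
this is the majorant for the limit `m → ∞`. -/
theorem psiTerm_bound {q a : ℂ} (hq : q ≠ 0) (hq1 : ‖q‖ < 1) {b₀ b₁ b₂ b₃ : ℂ}
    (h : ‖a ^ 2 * (b₀ * b₁ * b₂ * b₃) / q ^ 3‖ < 1) :
    ∃ C ρ : ℝ, 0 ≤ ρ ∧ ρ < 1 ∧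
      ∀ m k : ℕ, ‖psiTerm q a (b₀ * q ^ m) b₁ b₂ b₃ k‖ ≤ C * ρ ^ k := by
  have hr : 0 < ‖q‖ := norm_pos_iff.2 hq
  obtain ⟨R₀, R₁, R₂, R₃, p₀, p₁, p₂, p₃, e₀, e₁, e₂, e₃, hR⟩ := exists_radii h
  obtain ⟨C, hC, hb⟩ := exists_norm_pairs_le hq hq1 a p₀ p₁ p₂ p₃
  refine ⟨(1 + ‖a‖) * C, _, by positivity, hR, fun m k => ?_⟩
  have hm : ‖b₀ * q ^ m‖ ≤ R₀ := by
    rw [norm_mul, norm_pow]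
    exact (mul_le_of_le_one_right (norm_nonneg _) (pow_le_one₀ hr.le hq1.le)).trans e₀
  have := hb _ _ _ _ hm e₁ e₂ e₃ k
  have h1 : ‖1 - a * q ^ (2 * (k : ℤ))‖ ≤ 1 + ‖a‖ := by
    refine (norm_sub_le _ _).trans ?_
    rw [norm_one, norm_mul, show (2 * (k : ℤ)) = ((2 * k : ℕ) : ℤ) by push_cast; ring,
      zpow_natCast, norm_pow]
    gcongr
    exact mul_le_of_le_one_right (norm_nonneg _) (pow_le_one₀ hr.le hq1.le)
  have h2 : ‖a ^ (2 * (k : ℤ))‖ = (‖a‖ ^ 2) ^ k := by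
    rw [show (2 * (k : ℤ)) = ((2 * k : ℕ) : ℤ) by push_cast; ring, zpow_natCast, norm_pow, pow_mul]
  have h3 : ‖q ^ (2 * (k : ℤ) ^ 2 - k)‖ = ‖q‖ ^ (2 * k * (k + 1)) * ((‖q‖ ^ 3)⁻¹) ^ k := by
    have := zpow_two_sq_sub hr k 1
    rw [norm_zpow]; simpa using this
  rw [psiTerm, norm_mul, norm_mul, norm_mul (a ^ (2 * (k : ℤ))), h2, h3]
  generalize hn : ‖qPochInf q _ * qPochInf q _ * _ * _ * _‖ = n at *
  have hn0 : 0 ≤ n := hn ▸ norm_nonneg _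
  calc _ = ‖1 - a * q ^ (2 * (k : ℤ))‖ * ((‖a‖ ^ 2) ^ k * ((‖q‖ ^ 3)⁻¹) ^ k)
        * (n * ‖q‖ ^ (2 * k * (k + 1))) := by ring
    _ ≤ (1 + ‖a‖) * ((‖a‖ ^ 2) ^ k * ((‖q‖ ^ 3)⁻¹) ^ k) * (C * (R₀ * R₁ * R₂ * R₃) ^ k) := by
        gcongr
    _ = _ := by rw [div_eq_mul_inv]; simp only [mul_pow]; ring

theorem summable_psiCert_nat {q a : ℂ} (hq : q ≠ 0) (hq1 : ‖q‖ < 1) {b₀ b₁ b₂ b₃ : ℂ}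
    (h : ‖a ^ 2 * (b₀ * b₁ * b₂ * b₃) / q ^ 3‖ < 1) :
    Summable fun k : ℕ => psiCert q a b₀ b₁ b₂ b₃ k := by
  have hr : 0 < ‖q‖ := norm_pos_iff.2 hq
  obtain ⟨R₀, R₁, R₂, R₃, p₀, p₁, p₂, p₃, e₀, e₁, e₂, e₃, hR⟩ := exists_radii h
  -- Against `psiTerm`, the power `q^{2k²-2k}` of the certificate costs a factor `|q|^{-k}`. Its
  -- first pair involves `q b₀` in place of `b₀`, and the radius `|q| R₀` gains this factor back.
  obtain ⟨C, hC, hb⟩ := exists_norm_pairs_le hq hq1 a (mul_pos hr p₀) p₁ p₂ p₃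
  set ρ := ‖a‖ ^ 2 * (R₀ * R₁ * R₂ * R₃) / ‖q‖ ^ 3 with hρ
  have hρ0 : 0 ≤ ρ := by positivity
  set K := ‖b₀‖ * (1 + ‖a * b₀‖) * (1 + ‖a * b₁ * q⁻¹‖) * (1 + ‖a * b₂ * q⁻¹‖)
    * (1 + ‖a * b₃ * q⁻¹‖) * C with hK
  refine Summable.of_norm_bounded (g := fun k => K * ρ ^ k)
    ((summable_geometric_of_lt_one hρ0 hR).mul_left K) fun k => ?_
  have hm : ‖q * b₀‖ ≤ ‖q‖ * R₀ := by rw [norm_mul]; gcongr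
  have := hb _ _ _ _ hm e₁ e₂ e₃ k
  have h1 : ∀ b : ℂ, ‖1 - b * q ^ k‖ ≤ 1 + ‖b‖ := by
    intro b
    refine (norm_sub_le _ _).trans ?_
    rw [norm_one, norm_mul, norm_pow]
    gcongr
    exact mul_le_of_le_one_right (norm_nonneg _) (pow_le_one₀ hr.le hq1.le)
  have h2 : ‖a ^ (2 * (k : ℤ))‖ = (‖a‖ ^ 2) ^ k := by
    rw [show (2 * (k : ℤ)) = ((2 * k : ℕ) : ℤ) by push_cast; ring, zpow_natCast, norm_pow, pow_mul]
  have h3 : ‖q ^ (2 * (k : ℤ) ^ 2 - 2 * k)‖ = ‖q‖ ^ (2 * k * (k + 1)) * ((‖q‖ ^ 4)⁻¹) ^ k := by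
    have := zpow_two_sq_sub hr k 2
    rw [norm_zpow]; simpa using this
  have s0 : b₀ * q ^ (1 - (k : ℤ)) = q * b₀ * q ^ (-(k : ℤ)) := by
    rw [sub_eq_add_neg, zpow_add₀ hq, zpow_one]; ring
  have s1 : qPochInf q (a * b₀ * q ^ (k : ℤ))
      = (1 - a * b₀ * q ^ k) * qPochInf q (a * (q * b₀) * q ^ (k : ℤ)) := by
    rw [qPochInf_one_sub hq1, zpow_natCast]; congr 2; ring
  have t2 : ∀ b, qPochInf q (a * b * q ^ ((k : ℤ) - 1))
      = (1 - a * b * q⁻¹ * q ^ k) * qPochInf q (a * b * q ^ (k : ℤ)) := by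
    intro b
    rw [qPochInf_one_sub hq1, zpow_sub₀ hq, zpow_one, zpow_natCast]; congr 2 <;> field_simp
  have e : psiCert q a b₀ b₁ b₂ b₃ k = b₀ * ((1 - a * b₀ * q ^ k) * (1 - a * b₁ * q⁻¹ * q ^ k)
      * (1 - a * b₂ * q⁻¹ * q ^ k) * (1 - a * b₃ * q⁻¹ * q ^ k))
      * (a ^ (2 * (k : ℤ)) * q ^ (2 * (k : ℤ) ^ 2 - 2 * k))
      * ((qPochInf q (q * b₀ * q ^ (-(k : ℤ))) * qPochInf q (a * (q * b₀) * q ^ (k : ℤ)))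
        * (qPochInf q (b₁ * q ^ (-(k : ℤ))) * qPochInf q (a * b₁ * q ^ (k : ℤ)))
        * (qPochInf q (b₂ * q ^ (-(k : ℤ))) * qPochInf q (a * b₂ * q ^ (k : ℤ)))
        * (qPochInf q (b₃ * q ^ (-(k : ℤ))) * qPochInf q (a * b₃ * q ^ (k : ℤ)))) := by
    rw [psiCert, s0, s1, t2, t2, t2]; ring
  rw [e, norm_mul, norm_mul, norm_mul b₀, norm_mul (a ^ (2 * (k : ℤ))), h2, h3,
    norm_mul _ (1 - a * b₃ * q⁻¹ * q ^ k), norm_mul _ (1 - a * b₂ * q⁻¹ * q ^ k),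
    norm_mul (1 - a * b₀ * q ^ k)]
  have i0 := h1 (a * b₀)
  have i1 := h1 (a * b₁ * q⁻¹)
  have i2 := h1 (a * b₂ * q⁻¹)
  have i3 := h1 (a * b₃ * q⁻¹)
  generalize hn : ‖qPochInf q _ * qPochInf q _ * _ * _ * _‖ = n at *
  have hn0 : 0 ≤ n := hn ▸ norm_nonneg _
  calc _ = ‖b₀‖ * (‖1 - a * b₀ * q ^ k‖ * ‖1 - a * b₁ * q⁻¹ * q ^ k‖ * ‖1 - a * b₂ * q⁻¹ * q ^ k‖
        * ‖1 - a * b₃ * q⁻¹ * q ^ k‖) * ((‖a‖ ^ 2) ^ k * ((‖q‖ ^ 4)⁻¹) ^ k)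
        * (n * ‖q‖ ^ (2 * k * (k + 1))) := by ring
    _ ≤ ‖b₀‖ * ((1 + ‖a * b₀‖) * (1 + ‖a * b₁ * q⁻¹‖) * (1 + ‖a * b₂ * q⁻¹‖)
        * (1 + ‖a * b₃ * q⁻¹‖)) * ((‖a‖ ^ 2) ^ k * ((‖q‖ ^ 4)⁻¹) ^ k)
        * (C * (‖q‖ * R₀ * R₁ * R₂ * R₃) ^ k) := by
        gcongr
    _ = K * ((‖a‖ ^ 2) * ((‖q‖ ^ 4)⁻¹) * (‖q‖ * R₀ * R₁ * R₂ * R₃)) ^ k := by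
        rw [hK]; simp only [mul_pow]; ring
    _ = _ := by rw [hρ]; congr 2; field_simp

theorem psiTerm_argument_reflect {q a : ℂ} (hq : q ≠ 0) (ha : a ≠ 0) (b₀ b₁ b₂ b₃ : ℂ) :
    (q ^ 2 / a) ^ 2 * (a * b₀ / q * (a * b₁ / q) * (a * b₂ / q) * (a * b₃ / q)) / q ^ 3
      = a ^ 2 * (b₀ * b₁ * b₂ * b₃) / q ^ 3 := by
  field_simp

theorem summable_psiTerm_nat {q a : ℂ} (hq : q ≠ 0) (hq1 : ‖q‖ < 1) {b₀ b₁ b₂ b₃ : ℂ}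
    (h : ‖a ^ 2 * (b₀ * b₁ * b₂ * b₃) / q ^ 3‖ < 1) :
    Summable fun k : ℕ => psiTerm q a b₀ b₁ b₂ b₃ k := by
  obtain ⟨C, ρ, h0, h1, hb⟩ := psiTerm_bound hq hq1 h
  refine Summable.of_norm_bounded (g := fun k => C * ρ ^ k)
    ((summable_geometric_of_lt_one h0 h1).mul_left C) fun k => ?_
  simpa using hb 0 k

theorem hasSum_psiTerm_halves {q a : ℂ} (hq : q ≠ 0) (hq1 : ‖q‖ < 1) (ha : a ≠ 0)
    {b₀ b₁ b₂ b₃ : ℂ} (h : ‖a ^ 2 * (b₀ * b₁ * b₂ * b₃) / q ^ 3‖ < 1) :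
    HasSum (psiTerm q a b₀ b₁ b₂ b₃) ((∑' k : ℕ, psiTerm q a b₀ b₁ b₂ b₃ k) + -(q / a)
      * ∑' k : ℕ, psiTerm q (q ^ 2 / a) (a * b₀ / q) (a * b₁ / q) (a * b₂ / q) (a * b₃ / q) k) := by
  refine HasSum.of_nat_of_neg_add_one (summable_psiTerm_nat hq hq1 h).hasSum ?_
  simp only [psiTerm_neg hq ha]
  refine (summable_psiTerm_nat hq hq1 ?_).hasSum.mul_left _
  rwa [psiTerm_argument_reflect hq ha]

theorem summable_psiTerm {q a : ℂ} (hq : q ≠ 0) (hq1 : ‖q‖ < 1) (ha : a ≠ 0)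
    {b₀ b₁ b₂ b₃ : ℂ} (h : ‖a ^ 2 * (b₀ * b₁ * b₂ * b₃) / q ^ 3‖ < 1) :
    Summable (psiTerm q a b₀ b₁ b₂ b₃) :=
  (hasSum_psiTerm_halves hq hq1 ha h).summable

theorem tendsto_psiTerm {q : ℂ} (hq1 : ‖q‖ < 1) (a b₀ b₁ b₂ b₃ : ℂ) (k : ℤ) :
    Tendsto (fun m : ℕ => psiTerm q a (b₀ * q ^ m) b₁ b₂ b₃ k) atTop
      (𝓝 (psiTerm q a 0 b₁ b₂ b₃ k)) := by
  have h1 := tendsto_qPochInf_mul_pow hq1 (b₀ * q ^ (-k))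
  have h2 := tendsto_qPochInf_mul_pow hq1 (a * b₀ * q ^ k)
  have := ((((h1.mul h2).mul_const (qPochInf q (b₁ * q ^ (-k)) * qPochInf q (a * b₁ * q ^ k))).mul_const
    (qPochInf q (b₂ * q ^ (-k)) * qPochInf q (a * b₂ * q ^ k))).mul_const
    (qPochInf q (b₃ * q ^ (-k)) * qPochInf q (a * b₃ * q ^ k))).const_mul
    ((1 - a * q ^ (2 * k)) * (a ^ (2 * k) * q ^ (2 * k ^ 2 - k)))
  have e : psiTerm q a 0 b₁ b₂ b₃ k = (1 - a * q ^ (2 * k)) * (a ^ (2 * k) * q ^ (2 * k ^ 2 - k))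
      * (1 * 1 * (qPochInf q (b₁ * q ^ (-k)) * qPochInf q (a * b₁ * q ^ k))
        * (qPochInf q (b₂ * q ^ (-k)) * qPochInf q (a * b₂ * q ^ k))
        * (qPochInf q (b₃ * q ^ (-k)) * qPochInf q (a * b₃ * q ^ k))) := by
    simp [psiTerm, qPochInf_zero]
  rw [e]
  refine this.congr fun m => ?_
  simp only [psiTerm]
  rw [show b₀ * q ^ (-k) * q ^ m = b₀ * q ^ m * q ^ (-k) by ring,
    show a * b₀ * q ^ k * q ^ m = a * (b₀ * q ^ m) * q ^ k by ring]

theorem tendsto_tsum_psiTerm_nat {q a : ℂ} (hq : q ≠ 0) (hq1 : ‖q‖ < 1) {b₀ b₁ b₂ b₃ : ℂ}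
    (h : ‖a ^ 2 * (b₀ * b₁ * b₂ * b₃) / q ^ 3‖ < 1) :
    Tendsto (fun m : ℕ => ∑' k : ℕ, psiTerm q a (b₀ * q ^ m) b₁ b₂ b₃ k) atTop
      (𝓝 (∑' k : ℕ, psiTerm q a 0 b₁ b₂ b₃ k)) := by
  obtain ⟨C, ρ, h0, h1, hb⟩ := psiTerm_bound hq hq1 h
  exact tendsto_tsum_of_dominated_convergence ((summable_geometric_of_lt_one h0 h1).mul_left C)
    (fun k => tendsto_psiTerm hq1 a b₀ b₁ b₂ b₃ k) (Eventually.of_forall fun m k => hb m k)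

theorem norm_mul_pow_lt {q D : ℂ} (hq1 : ‖q‖ < 1) (h : ‖D‖ < 1) (m : ℕ) : ‖D * q ^ m‖ < 1 := by
  rw [norm_mul, norm_pow]
  exact (mul_le_of_le_one_right (norm_nonneg _) (pow_le_one₀ (norm_nonneg _) hq1.le)).trans_lt h

theorem tendsto_tsum_psiTerm {q a : ℂ} (hq : q ≠ 0) (hq1 : ‖q‖ < 1) (ha : a ≠ 0)
    {b₀ b₁ b₂ b₃ : ℂ} (h : ‖a ^ 2 * (b₀ * b₁ * b₂ * b₃) / q ^ 3‖ < 1) :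
    Tendsto (fun m : ℕ => ∑' k : ℤ, psiTerm q a (b₀ * q ^ m) b₁ b₂ b₃ k) atTop
      (𝓝 (∑' k : ℤ, psiTerm q a 0 b₁ b₂ b₃ k)) := by
  have e0 : ‖a ^ 2 * (0 * b₁ * b₂ * b₃) / q ^ 3‖ < 1 := by simp
  have e1 := (psiTerm_argument_reflect hq ha b₀ b₁ b₂ b₃).symm ▸ h
  rw [(hasSum_psiTerm_halves hq hq1 ha e0).tsum_eq]
  have := (tendsto_tsum_psiTerm_nat hq hq1 h).add
    ((tendsto_tsum_psiTerm_nat hq hq1 e1).const_mul (-(q / a)))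
  rw [mul_zero, zero_div]
  refine this.congr fun m => ?_
  have em : ‖a ^ 2 * (b₀ * q ^ m * b₁ * b₂ * b₃) / q ^ 3‖ < 1 := by
    have := norm_mul_pow_lt hq1 h m
    rwa [show a ^ 2 * (b₀ * b₁ * b₂ * b₃) / q ^ 3 * q ^ m
      = a ^ 2 * (b₀ * q ^ m * b₁ * b₂ * b₃) / q ^ 3 by ring] at this
  rw [(hasSum_psiTerm_halves hq hq1 ha em).tsum_eq,
    show a * b₀ / q * q ^ m = a * (b₀ * q ^ m) / q by ring]

/-! ### Evaluation of the ₆ψ₆ series. -/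

theorem tsum_psiTerm_contiguous {q a : ℂ} (hq : q ≠ 0) (hq1 : ‖q‖ < 1) (ha : a ≠ 0)
    {b₀ b₁ b₂ b₃ : ℂ} (h : ‖a ^ 2 * (b₀ * b₁ * b₂ * b₃) / q ^ 3‖ < 1) :
    (1 - a ^ 2 * (b₀ * b₁ * b₂ * b₃) / q ^ 3) * ∑' k, psiTerm q a b₀ b₁ b₂ b₃ k
      = (1 - a * b₀ * b₁ / q) * (1 - a * b₀ * b₂ / q) * (1 - a * b₀ * b₃ / q)
        * ∑' k, psiTerm q a (q * b₀) b₁ b₂ b₃ k := by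
  have h1 : ‖a ^ 2 * (q * b₀ * b₁ * b₂ * b₃) / q ^ 3‖ < 1 := by
    have := norm_mul_pow_lt hq1 h 1
    rwa [show a ^ 2 * (b₀ * b₁ * b₂ * b₃) / q ^ 3 * q ^ 1
      = a ^ 2 * (q * b₀ * b₁ * b₂ * b₃) / q ^ 3 by ring] at this
  have hG : Summable (psiCert q a b₀ b₁ b₂ b₃) := by
    refine Summable.of_nat_of_neg (summable_psiCert_nat hq hq1 h) ?_
    simp only [psiCert_neg hq ha]
    refine (summable_psiCert_nat hq hq1 ?_).mul_left _
    rwa [psiTerm_argument_reflect hq ha]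
  have hS := (Equiv.addRight (1 : ℤ)).summable_iff.2 hG
  have e1 := (Equiv.addRight (1 : ℤ)).tsum_eq (psiCert q a b₀ b₁ b₂ b₃)
  -- The sum of a summable family over ℤ is invariant under translation, so the telescoping leaves
  -- no boundary terms.
  have e2 : ∑' k, ((psiCert q a b₀ b₁ b₂ b₃ ∘ Equiv.addRight (1 : ℤ)) k - psiCert q a b₀ b₁ b₂ b₃ k) = 0 := by
    rw [hS.tsum_sub hG]
    exact sub_eq_zero.2 e1
  have e3 : ∀ k, (psiCert q a b₀ b₁ b₂ b₃ ∘ Equiv.addRight (1 : ℤ)) k - psiCert q a b₀ b₁ b₂ b₃ k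
      = (1 - a ^ 2 * (b₀ * b₁ * b₂ * b₃) / q ^ 3) * psiTerm q a b₀ b₁ b₂ b₃ k
      - (1 - a * b₀ * b₁ / q) * (1 - a * b₀ * b₂ / q) * (1 - a * b₀ * b₃ / q)
        * psiTerm q a (q * b₀) b₁ b₂ b₃ k := fun k =>
    (psiTerm_contiguous hq hq1 ha b₀ b₁ b₂ b₃ k).symm
  rw [tsum_congr e3, Summable.tsum_sub ((summable_psiTerm hq hq1 ha h).mul_left _)
    ((summable_psiTerm hq hq1 ha h1).mul_left _), tsum_mul_left, tsum_mul_left] at e2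
  exact sub_eq_zero.1 e2

theorem tsum_psiTerm_iterate {q a : ℂ} (hq : q ≠ 0) (hq1 : ‖q‖ < 1) (ha : a ≠ 0)
    {b₀ b₁ b₂ b₃ : ℂ} (h : ‖a ^ 2 * (b₀ * b₁ * b₂ * b₃) / q ^ 3‖ < 1) (m : ℕ) :
    qPochInf q (a ^ 2 * (b₀ * b₁ * b₂ * b₃) / q ^ 3) * ∑' k, psiTerm q a b₀ b₁ b₂ b₃ k
      = qPoch q (a * b₀ * b₁ / q) m * qPoch q (a * b₀ * b₂ / q) m * qPoch q (a * b₀ * b₃ / q) m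
        * (qPochInf q (a ^ 2 * (b₀ * b₁ * b₂ * b₃) / q ^ 3 * q ^ m)
          * ∑' k, psiTerm q a (b₀ * q ^ m) b₁ b₂ b₃ k) := by
  induction m with
  | zero => simp [qPoch_zero]
  | succ m ih =>
    have hm : ‖a ^ 2 * (b₀ * q ^ m * b₁ * b₂ * b₃) / q ^ 3‖ < 1 := by
      have := norm_mul_pow_lt hq1 h m
      rwa [show a ^ 2 * (b₀ * b₁ * b₂ * b₃) / q ^ 3 * q ^ m
        = a ^ 2 * (b₀ * q ^ m * b₁ * b₂ * b₃) / q ^ 3 by ring] at this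
    have hc := tsum_psiTerm_contiguous hq hq1 ha hm
    rw [show q * (b₀ * q ^ m) = b₀ * q ^ (m + 1) by ring] at hc
    rw [ih, qPochInf_one_sub hq1 (_ * q ^ m), qPoch_succ, qPoch_succ, qPoch_succ,
      show a ^ 2 * (b₀ * b₁ * b₂ * b₃) / q ^ 3 * q ^ m * q
        = a ^ 2 * (b₀ * b₁ * b₂ * b₃) / q ^ 3 * q ^ (m + 1) by ring]
    linear_combination qPoch q (a * b₀ * b₁ / q) m * qPoch q (a * b₀ * b₂ / q) m
      * qPoch q (a * b₀ * b₃ / q) m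
      * qPochInf q (a ^ 2 * (b₀ * b₁ * b₂ * b₃) / q ^ 3 * q ^ (m + 1)) * hc

/-- Let `m → ∞` in `tsum_psiTerm_iterate`, whose left side does not depend on `m`: the finite
factorials tend to infinite ones, and the factorial with shifted argument tends to `1`. -/
theorem tsum_psiTerm_reduce {q a : ℂ} (hq : q ≠ 0) (hq1 : ‖q‖ < 1) (ha : a ≠ 0)
    {b₀ b₁ b₂ b₃ : ℂ} (h : ‖a ^ 2 * (b₀ * b₁ * b₂ * b₃) / q ^ 3‖ < 1) :
    qPochInf q (a ^ 2 * (b₀ * b₁ * b₂ * b₃) / q ^ 3) * ∑' k, psiTerm q a b₀ b₁ b₂ b₃ k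
      = qPochInf q (a * b₀ * b₁ / q) * qPochInf q (a * b₀ * b₂ / q) * qPochInf q (a * b₀ * b₃ / q)
        * ∑' k, psiTerm q a 0 b₁ b₂ b₃ k := by
  have h1 := (((tendsto_qPoch hq1 (a * b₀ * b₁ / q)).mul (tendsto_qPoch hq1 (a * b₀ * b₂ / q))).mul
    (tendsto_qPoch hq1 (a * b₀ * b₃ / q))).mul
    ((tendsto_qPochInf_mul_pow hq1 (a ^ 2 * (b₀ * b₁ * b₂ * b₃) / q ^ 3)).mul
      (tendsto_tsum_psiTerm hq hq1 ha h))
  rw [one_mul] at h1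
  exact tendsto_nhds_unique (tendsto_const_nhds.congr (tsum_psiTerm_iterate hq hq1 ha h)) h1

/-- `psiTerm` is symmetric in the `bᵢ`, so each can be moved to the front and sent to `0`, which
produces its products with the parameters still present. Once one parameter is `0`, so is the
argument of the series, and convergence is automatic. -/
theorem tsum_psiTerm_reduce_all {q a : ℂ} (hq : q ≠ 0) (hq1 : ‖q‖ < 1) (ha : a ≠ 0)
    {b₀ b₁ b₂ b₃ : ℂ} (h : ‖a ^ 2 * (b₀ * b₁ * b₂ * b₃) / q ^ 3‖ < 1) :
    qPochInf q (a ^ 2 * (b₀ * b₁ * b₂ * b₃) / q ^ 3) * ∑' k, psiTerm q a b₀ b₁ b₂ b₃ k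
      = qPochInf q (a * b₀ * b₁ / q) * qPochInf q (a * b₀ * b₂ / q) * qPochInf q (a * b₀ * b₃ / q)
        * (qPochInf q (a * b₁ * b₂ / q) * qPochInf q (a * b₁ * b₃ / q)
          * qPochInf q (a * b₂ * b₃ / q))
        * ∑' k, psiTerm q a 0 0 0 0 k := by
  have s1 : ∀ c₀ c₁ c₂ c₃ : ℂ, psiTerm q a c₀ c₁ c₂ c₃ = psiTerm q a c₁ c₀ c₂ c₃ := by
    intros; ext; simp only [psiTerm]; ring
  have s2 : ∀ c₀ c₁ c₂ c₃ : ℂ, psiTerm q a c₀ c₁ c₂ c₃ = psiTerm q a c₂ c₀ c₁ c₃ := by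
    intros; ext; simp only [psiTerm]; ring
  have s3 : ∀ c₀ c₁ c₂ c₃ : ℂ, psiTerm q a c₀ c₁ c₂ c₃ = psiTerm q a c₃ c₀ c₁ c₂ := by
    intros; ext; simp only [psiTerm]; ring
  have r1 := tsum_psiTerm_reduce hq hq1 ha (b₀ := b₁) (b₁ := 0) (b₂ := b₂) (b₃ := b₃) (by simp)
  have r2 := tsum_psiTerm_reduce hq hq1 ha (b₀ := b₂) (b₁ := 0) (b₂ := 0) (b₃ := b₃) (by simp)
  have r3 := tsum_psiTerm_reduce hq hq1 ha (b₀ := b₃) (b₁ := 0) (b₂ := 0) (b₃ := 0) (by simp)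
  simp only [mul_zero, zero_mul, zero_div, qPochInf_zero, one_mul, mul_one] at r1 r2 r3
  rw [tsum_psiTerm_reduce hq hq1 ha h, s1 0, r1, s2 0, r2, s3 0, r3]
  ring

/-- The Jacobi triple product, in the form of the sum of its terms taken in pairs. -/
theorem tsum_psiTerm_zero {q a : ℂ} (hq : q ≠ 0) (hq1 : ‖q‖ < 1) (ha : a ≠ 0) :
    ∑' k, psiTerm q a 0 0 0 0 k = qPochInf q q * qPochInf q a * qPochInf q (q / a) := by
  have h := tsum_psiTerm_reduce_all hq hq1 ha (b₀ := q) (b₁ := q / a) (b₂ := 0) (b₃ := 0) (by simp)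
  -- With `b₀ = q` the factor `(q^{1-k}; q)_∞` kills every `k > 0`; with `b₁ = q/a` the factor
  -- `(q^{1+k}; q)_∞` kills every `k < 0`.
  have hz : ∀ k : ℤ, k ≠ 0 → psiTerm q a q (q / a) 0 0 k = 0 := by
    intro k hk
    rcases lt_or_gt_of_ne hk with hk | hk
    · obtain ⟨j, hj⟩ : ∃ j : ℕ, k = -(j + 1) := ⟨(-k - 1).toNat, by omega⟩
      have : qPochInf q (a * (q / a) * q ^ k) = 0 := by
        refine qPochInf_eq_zero hq1 j ?_
        rw [hj, zpow_neg, zpow_add₀ hq, zpow_one, zpow_natCast]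
        field_simp
      rw [psiTerm, this]; ring
    · obtain ⟨j, hj⟩ : ∃ j : ℕ, k = j + 1 := ⟨(k - 1).toNat, by omega⟩
      have : qPochInf q (q * q ^ (-k)) = 0 := by
        refine qPochInf_eq_zero hq1 j ?_
        rw [hj, zpow_neg, zpow_add₀ hq, zpow_one, zpow_natCast]
        field_simp
      rw [psiTerm, this]; ring
  rw [tsum_eq_single 0 fun k hk => hz k hk] at h
  generalize ∑' k, psiTerm q a 0 0 0 0 k = S at *
  have e1 : a * q * (q / a) / q = q := by field_simp
  have e2 : a * (q / a) = q := by field_simp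
  simp only [psiTerm, mul_zero, zero_div, qPochInf_zero, one_mul, mul_one, neg_zero,
    zpow_zero, e1, e2] at h
  norm_num at h
  have h0 := qPochInf_self_ne_zero hq1
  refine mul_left_cancel₀ h0 ?_
  rw [← h, qPochInf_one_sub hq1 a]
  ring

/-- Bailey's `₆ψ₆` summation. -/
theorem tsum_psiTerm {q a : ℂ} (hq : q ≠ 0) (hq1 : ‖q‖ < 1) (ha : a ≠ 0)
    {b₀ b₁ b₂ b₃ : ℂ} (h : ‖a ^ 2 * (b₀ * b₁ * b₂ * b₃) / q ^ 3‖ < 1) :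
    ∑' k, psiTerm q a b₀ b₁ b₂ b₃ k
      = qPochInf q q * qPochInf q a * qPochInf q (q / a)
        * (qPochInf q (a * b₀ * b₁ / q) * qPochInf q (a * b₀ * b₂ / q)
          * qPochInf q (a * b₀ * b₃ / q) * qPochInf q (a * b₁ * b₂ / q)
          * qPochInf q (a * b₁ * b₃ / q) * qPochInf q (a * b₂ * b₃ / q))
        / qPochInf q (a ^ 2 * (b₀ * b₁ * b₂ * b₃) / q ^ 3) := by
  rw [eq_div_iff (qPochInf_ne_zero_of_norm_lt hq1 h), mul_comm,
    tsum_psiTerm_reduce_all hq hq1 ha h, tsum_psiTerm_zero hq hq1 ha]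
  ring

/-! ### The `q`-Pfaff–Saalschütz expansion and shifts of `y`. -/

/-- A denominator-free form of the `q`-Pfaff–Saalschütz sum: expansion of `(hv, hw; q)_N` in the
products `(v, w; q)_m`. -/
theorem qPoch_mul_expand {q : ℂ} (hq1 : ‖q‖ < 1) (h v w : ℂ) (N : ℕ) :
    qPoch q (h * v) N * qPoch q (h * w) N
      = ∑ m ∈ Finset.range (N + 1), qPoch q q N / (qPoch q q m * qPoch q q (N - m)) * h ^ m
        * qPoch q h (N - m) * qPoch q (h * v * w * q ^ m) (N - m)
        * (qPoch q v m * qPoch q w m) := by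
  induction N with
  | zero => simp [qPoch]
  | succ N ih =>
    set α : ℕ → ℂ := fun m => qPoch q q N / (qPoch q q m * qPoch q q (N - m)) * h ^ m
        * qPoch q h (N - m) * qPoch q (h * v * w * q ^ m) (N - m) with hα
    set γ : ℕ → ℂ := fun m => qPoch q q (N + 1) / (qPoch q q m * qPoch q q (N + 1 - m)) * h ^ m
        * qPoch q h (N + 1 - m) * qPoch q (h * v * w * q ^ m) (N + 1 - m) with hγ
    have hQ : ∀ k, qPoch q q k ≠ 0 := qPoch_self_ne_zero hq1
    have hQs : ∀ k, qPoch q q (k + 1) = qPoch q q k * (1 - q ^ (k + 1)) := fun k => by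
      rw [qPoch_succ, pow_succ']
    have hQ1 : ∀ k : ℕ, 1 - q ^ (k + 1) ≠ 0 := fun k h0 => by
      have := hQ (k + 1); rw [hQs, h0] at this; simp at this
    have r0 : γ 0 = α 0 * ((1 - h * q ^ N) * (1 - h * v * w * q ^ N)) := by
      simp only [hα, hγ, qPoch_zero, Nat.sub_zero, pow_zero, one_mul, mul_one, qPoch_succ]
      rw [← qPoch_succ, div_self (hQ _), div_self (hQ _)]; ring
    have rl : γ (N + 1) = α N * (h * q ^ 0) := by
      simp only [hα, hγ, Nat.sub_self, qPoch_zero, mul_one, div_self (hQ _)]; ring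
    -- The Pascal-type recurrence of the coefficients; `r0` and `rl` are its two boundary cases.
    have rm : ∀ m < N, γ (m + 1) = α (m + 1) * ((1 - h * q ^ (N - (m + 1)))
        * (1 - h * v * w * q ^ (N + (m + 1)))) + α m * (h * q ^ (N - m)) := by
      intro m hm
      obtain ⟨j, rfl⟩ := Nat.exists_eq_add_of_lt hm
      simp only [hα, hγ]
      have e1 : m + j + 1 - (m + 1) = j := by omega
      have e2 : m + j + 1 + 1 - (m + 1) = j + 1 := by omega
      have e3 : m + j + 1 - m = j + 1 := by omega
      rw [e1, e2, e3]
      have p1 : qPoch q (h * v * w * q ^ (m + 1)) (j + 1)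
          = qPoch q (h * v * w * q ^ (m + 1)) j * (1 - h * v * w * q ^ (m + 1) * q ^ j) :=
        qPoch_succ _ _ _
      have p2 : qPoch q (h * v * w * q ^ m) (j + 1)
          = (1 - h * v * w * q ^ m) * qPoch q (h * v * w * q ^ (m + 1)) j := by
        rw [qPoch_succ']; congr 2; ring
      rw [p1, p2, qPoch_succ q h, hQs (m + j + 1), hQs m, hQs j]
      have a1 := hQ m
      have a2 := hQ j
      have a3 := hQ1 m
      have a4 := hQ1 j
      field_simp
      ring
    -- The new factor is split differently for each `m`, so that one part keeps `(v, w; q)_m` and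
    -- the other raises it to `(v, w; q)_{m+1}`.
    have step : ∀ m ∈ Finset.range (N + 1), α m * (qPoch q v m * qPoch q w m)
        * ((1 - h * v * q ^ N) * (1 - h * w * q ^ N))
        = α m * ((1 - h * q ^ (N - m)) * (1 - h * v * w * q ^ (N + m)))
            * (qPoch q v m * qPoch q w m)
          + α m * (h * q ^ (N - m)) * (qPoch q v (m + 1) * qPoch q w (m + 1)) := by
      intro m hm
      obtain ⟨j, rfl⟩ := Nat.exists_eq_add_of_le (Nat.lt_succ_iff.1 (Finset.mem_range.1 hm))
      rw [qPoch_succ q v, qPoch_succ q w, Nat.add_sub_cancel_left]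
      ring
    rw [qPoch_succ, qPoch_succ]
    calc _ = (qPoch q (h * v) N * qPoch q (h * w) N)
          * ((1 - h * v * q ^ N) * (1 - h * w * q ^ N)) := by ring
      _ = ∑ m ∈ Finset.range (N + 1),
          (α m * ((1 - h * q ^ (N - m)) * (1 - h * v * w * q ^ (N + m)))
            * (qPoch q v m * qPoch q w m)
          + α m * (h * q ^ (N - m)) * (qPoch q v (m + 1) * qPoch q w (m + 1))) := by
        rw [ih, Finset.sum_mul]
        exact Finset.sum_congr rfl step
      _ = ∑ m ∈ Finset.range (N + 1 + 1), γ m * (qPoch q v m * qPoch q w m) := by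
        rw [Finset.sum_add_distrib, Finset.sum_range_succ' _ N, Finset.sum_range_succ' _ (N + 1),
          Finset.sum_range_succ _ N, Finset.sum_range_succ _ N, r0, rl]
        have : ∑ m ∈ Finset.range N, γ (m + 1) * (qPoch q v (m + 1) * qPoch q w (m + 1))
            = ∑ m ∈ Finset.range N, (α (m + 1) * ((1 - h * q ^ (N - (m + 1)))
              * (1 - h * v * w * q ^ (N + (m + 1)))) * (qPoch q v (m + 1) * qPoch q w (m + 1)))
            + ∑ m ∈ Finset.range N, α m * (h * q ^ (N - m))
              * (qPoch q v (m + 1) * qPoch q w (m + 1)) := by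
          rw [← Finset.sum_add_distrib]
          refine Finset.sum_congr rfl fun m hm => ?_
          rw [rm m (Finset.mem_range.1 hm)]; ring
        rw [this]
        simp only [Nat.sub_self, Nat.sub_zero, Nat.add_zero]
        ring

/-- With `a = q/x` and `b₀ = xy`, reversing the factors `1 - q^{i-k}/y` and `1 - q^{i+k+1}/(xy)`
gives just the factors by which `(a b₀ q^k; q)_∞` and `(b₀ q^{-k}; q)_∞` are extended to the left.
The powers of `q^k` lost in the two reversals cancel. -/
theorem psiTerm_mul_qPoch {q x y : ℂ} (hq : q ≠ 0) (hq1 : ‖q‖ < 1) (hx : x ≠ 0) (hy : y ≠ 0)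
    (b₁ b₂ b₃ : ℂ) (k : ℤ) (m : ℕ) :
    psiTerm q (q / x) (x * y) b₁ b₂ b₃ k
        * (qPoch q (q ^ (-k) / y) m * qPoch q (q / x * q ^ k / y) m) * (x * y ^ 2) ^ m
      = q ^ m ^ 2 * psiTerm q (q / x) (x * (y * (q ^ m)⁻¹)) b₁ b₂ b₃ k := by
  induction m with
  | zero => simp [qPoch_zero]
  | succ m ih =>
    have hu : q ^ k ≠ 0 := zpow_ne_zero k hq
    have s0 : qPochInf q (x * (y * (q ^ (m + 1))⁻¹) * q ^ (-k))
        = (1 - x * (y * (q ^ (m + 1))⁻¹) * q ^ (-k))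
          * qPochInf q (x * (y * (q ^ m)⁻¹) * q ^ (-k)) := by
      rw [qPochInf_one_sub hq1]; congr 2; rw [pow_succ]; field_simp
    have s1 : qPochInf q (q / x * (x * (y * (q ^ (m + 1))⁻¹)) * q ^ k)
        = (1 - q / x * (x * (y * (q ^ (m + 1))⁻¹)) * q ^ k)
          * qPochInf q (q / x * (x * (y * (q ^ m)⁻¹)) * q ^ k) := by
      rw [qPochInf_one_sub hq1]; congr 2; rw [pow_succ]; field_simp
    have e : psiTerm q (q / x) (x * (y * (q ^ (m + 1))⁻¹)) b₁ b₂ b₃ k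
        = (1 - x * (y * (q ^ (m + 1))⁻¹) * q ^ (-k))
          * (1 - q / x * (x * (y * (q ^ (m + 1))⁻¹)) * q ^ k)
          * psiTerm q (q / x) (x * (y * (q ^ m)⁻¹)) b₁ b₂ b₃ k := by
      rw [psiTerm, s0, s1, psiTerm]; ring
    have key : (1 - q ^ (-k) / y * q ^ m) * (1 - q / x * q ^ k / y * q ^ m) * (x * y ^ 2)
        = q ^ (2 * m + 1) * ((1 - x * (y * (q ^ (m + 1))⁻¹) * q ^ (-k))
          * (1 - q / x * (x * (y * (q ^ (m + 1))⁻¹)) * q ^ k)) := by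
      rw [zpow_neg]
      field_simp
      ring
    rw [e, qPoch_succ, qPoch_succ, show (m + 1) ^ 2 = m ^ 2 + (2 * m + 1) by ring,
      pow_add q (m ^ 2), pow_succ (x * y ^ 2)]
    calc _ = (psiTerm q (q / x) (x * y) b₁ b₂ b₃ k
          * (qPoch q (q ^ (-k) / y) m * qPoch q (q / x * q ^ k / y) m) * (x * y ^ 2) ^ m)
          * ((1 - q ^ (-k) / y * q ^ m) * (1 - q / x * q ^ k / y * q ^ m) * (x * y ^ 2)) := by ring
      _ = _ := by rw [ih, key]; ring

/-- The coefficient of the expansion of the factor with parameter `X` in the shifts of `y`. -/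
noncomputable def shiftCoeff (q e X : ℂ) (N m : ℕ) : ℂ :=
  qPoch q q N / (qPoch q q m * qPoch q q (N - m)) * X ^ m
    * qPoch q X (N - m) * qPoch q (q * X / e * q ^ m) (N - m) * (e ^ m)⁻¹ * q ^ m ^ 2

theorem psiTerm_mul_expand {q x y : ℂ} (hq : q ≠ 0) (hq1 : ‖q‖ < 1) (hx : x ≠ 0) (hy : y ≠ 0)
    (b₁ b₂ b₃ X : ℂ) (N : ℕ) (k : ℤ) :
    psiTerm q (q / x) (x * y) b₁ b₂ b₃ k
        * (qPoch q (X / y * q ^ (-k)) N * qPoch q (q / x * (X / y) * q ^ k) N)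
      = ∑ m ∈ Finset.range (N + 1), shiftCoeff q (x * y ^ 2) X N m
        * psiTerm q (q / x) (x * (y * (q ^ m)⁻¹)) b₁ b₂ b₃ k := by
  have hu : q ^ k ≠ 0 := zpow_ne_zero k hq
  have h := qPoch_mul_expand hq1 X (q ^ (-k) / y) (q / x * q ^ k / y) N
  rw [show X / y * q ^ (-k) = X * (q ^ (-k) / y) by ring,
    show q / x * (X / y) * q ^ k = X * (q / x * q ^ k / y) by ring, h, Finset.mul_sum]
  refine Finset.sum_congr rfl fun m _ => ?_
  have h1 := psiTerm_mul_qPoch hq hq1 hx hy b₁ b₂ b₃ k m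
  -- This product is free of `k`, which makes the coefficients of the expansion constants.
  have h2 : X * (q ^ (-k) / y) * (q / x * q ^ k / y) = q * X / (x * y ^ 2) := by
    rw [zpow_neg]; field_simp
  have h3 : (x * y ^ 2) ^ m ≠ 0 := by positivity
  rw [h2, shiftCoeff]
  have h4 : psiTerm q (q / x) (x * y) b₁ b₂ b₃ k
        * (qPoch q (q ^ (-k) / y) m * qPoch q (q / x * q ^ k / y) m)
      = ((x * y ^ 2) ^ m)⁻¹ * (q ^ m ^ 2
        * psiTerm q (q / x) (x * (y * (q ^ m)⁻¹)) b₁ b₂ b₃ k) := by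
    rw [← h1]; field_simp
  linear_combination (qPoch q q N / (qPoch q q m * qPoch q q (N - m)) * X ^ m
    * qPoch q X (N - m) * qPoch q (q * X / (x * y ^ 2) * q ^ m) (N - m)) * h4

/-! ### The multiple sum and its recursion in the first index. -/

/-- The partial sum `m_1 + ⋯ + m_{s-1}` (indices below `s`). -/
def partialSumBefore {n : ℕ} (m : Fin n → ℕ) (s : Fin n) : ℕ :=
  ∑ i ∈ Finset.Iio s, m i

theorem partialSum_eq_ite {n : ℕ} (m : Fin n → ℕ) (s : Fin n) :
    partialSum m s = ∑ i, if i ≤ s then m i else 0 := by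
  rw [partialSum, ← Finset.sum_filter]
  congr 1; ext; simp

theorem partialSumBefore_eq_ite {n : ℕ} (m : Fin n → ℕ) (s : Fin n) :
    partialSumBefore m s = ∑ i, if i < s then m i else 0 := by
  rw [partialSumBefore, ← Finset.sum_filter]
  congr 1; ext; simp

theorem partialSum_cons_zero {n : ℕ} (j : ℕ) (m : Fin n → ℕ) :
    partialSum (Fin.cons j m : Fin (n + 1) → ℕ) 0 = j := by
  simp [partialSum_eq_ite]

theorem partialSum_cons_succ {n : ℕ} (j : ℕ) (m : Fin n → ℕ) (s : Fin n) :
    partialSum (Fin.cons j m : Fin (n + 1) → ℕ) s.succ = j + partialSum m s := by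
  simp [partialSum_eq_ite, Fin.sum_univ_succ]

theorem partialSumBefore_zero {n : ℕ} (m : Fin (n + 1) → ℕ) : partialSumBefore m 0 = 0 := by
  simp [partialSumBefore_eq_ite]

theorem partialSumBefore_cons_succ {n : ℕ} (j : ℕ) (m : Fin n → ℕ) (s : Fin n) :
    partialSumBefore (Fin.cons j m : Fin (n + 1) → ℕ) s.succ = j + partialSumBefore m s := by
  simp [partialSumBefore_eq_ite, Fin.sum_univ_succ]

theorem partialSumBefore_succ {n : ℕ} (m : Fin n → ℕ) (s : Fin n) (h : s.val + 1 < n) :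
    partialSumBefore m ⟨s.val + 1, h⟩ = partialSum m s := by
  rw [partialSumBefore_eq_ite, partialSum_eq_ite]
  simp only [Fin.lt_def, Fin.le_def, Nat.lt_succ_iff]

theorem partialSum_last {n : ℕ} (m : Fin (n + 1) → ℕ) : partialSum m (Fin.last n) = ∑ i, m i := by
  simp [partialSum_eq_ite, Fin.le_last]

/-- Reindexes the factors that carry parameters of index `s + 1` at position `s`; the condition `f 0
= 1` fills the vacant first place. -/
theorem prod_dite_succ {n : ℕ} (f g : Fin (n + 1) → ℂ) (h0 : f 0 = 1) :
    (∏ s : Fin (n + 1), if h : s.val + 1 < n + 1 then f ⟨s.val + 1, h⟩ else g s)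
      = (∏ s, f s) * g (Fin.last n) := by
  rw [Fin.prod_univ_castSucc, Fin.prod_univ_succ, h0, one_mul]
  congr 1
  · refine Finset.prod_congr rfl fun s _ => ?_
    have : s.castSucc.val + 1 < n + 1 := by simp
    rw [dif_pos this]; rfl
  · simp

/-- The multiple sum's summand, with the factors regrouped by the index of the parameters. -/
theorem multiTerm_eq {n : ℕ} (q x y b c d : ℂ) (X Y : Fin n → ℂ) (m : Fin n → ℕ) :
    multiTerm q x y b c d X Y m
      = (∏ s, qPoch q (X s * Y s / (x * y ^ 2)) (m s) / qPoch q q (m s)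
          / (qPoch q (q * X s / (x * y ^ 2)) (partialSum m s)
            * qPoch q (q * Y s / (x * y ^ 2)) (partialSum m s))
          * (qPoch q (q / X s) (partialSumBefore m s) * qPoch q (q / Y s) (partialSumBefore m s)
            * (X s * Y s / (x * y ^ 2)) ^ partialSumBefore m s))
        * (qPoch q (q / b) (∑ i, m i) * qPoch q (q / c) (∑ i, m i) * qPoch q (q / d) (∑ i, m i)
          / qPoch q (q ^ 2 * (x * y ^ 2) / (b * c * d)) (∑ i, m i) * q ^ ∑ i, m i) := by
  cases n with
  | zero => simp [multiTerm, qPoch]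
  | succ n =>
    set f : Fin (n + 1) → ℂ := fun s => qPoch q (q / X s) (partialSumBefore m s)
      * qPoch q (q / Y s) (partialSumBefore m s)
      * (X s * Y s / (x * y ^ 2)) ^ partialSumBefore m s with hf
    set g : Fin (n + 1) → ℂ := fun s => qPoch q (q / b) (partialSum m s)
      * qPoch q (q / c) (partialSum m s) * qPoch q (q / d) (partialSum m s)
      / qPoch q (q ^ 2 * (x * y ^ 2) / (b * c * d)) (partialSum m s) * q ^ partialSum m s with hg
    have h := prod_dite_succ f g (by simp [hf, partialSumBefore_zero, qPoch])
    rw [Finset.prod_mul_distrib, mul_assoc, ← partialSum_last, ← h, ← Finset.prod_mul_distrib,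
      multiTerm]
    refine Finset.prod_congr rfl fun s _ => ?_
    by_cases hs : s.val + 1 < n + 1
    · simp only [dif_pos hs, hf, partialSumBefore_succ, qPochs, List.map_cons, List.map_nil,
        List.prod_cons, List.prod_nil, mul_one]
      ring
    · simp only [dif_neg hs, hg, qPochs, List.map_cons, List.map_nil,
        List.prod_cons, List.prod_nil, mul_one]
      ring

/-- The factor of `multiTerm` for `n + 1` indices that depends on the first index only. -/
noncomputable def multiHead {n : ℕ} (q e b c d X₀ Y₀ : ℂ) (X Y : Fin n → ℂ) (j : ℕ) : ℂ :=
  qPoch q (X₀ * Y₀ / e) j / qPoch q q j / (qPoch q (q * X₀ / e) j * qPoch q (q * Y₀ / e) j)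
    * (∏ s, qPoch q (q / X s) j * qPoch q (q / Y s) j * (X s * Y s / e) ^ j
      / (qPoch q (q * X s / e) j * qPoch q (q * Y s / e) j))
    * (qPoch q (q / b) j * qPoch q (q / c) j * qPoch q (q / d) j
      / qPoch q (q ^ 2 * e / (b * c * d)) j * q ^ j)

/-- All later partial sums grow by `j`, and `(u; q)_{j+M} = (u; q)_j (u q^j; q)_M`. The shift by
`q^j` is absorbed by multiplying `y, b, c, d, X, Y` by `q^{-j}`, which leaves `X Y / (x y²)`, and
hence each `N i`, unchanged. -/
theorem multiTerm_cons {n : ℕ} {q : ℂ} (hq : q ≠ 0) (x y b c d X₀ Y₀ : ℂ) (X Y : Fin n → ℂ)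
    (j : ℕ) (m : Fin n → ℕ) :
    multiTerm q x y b c d (Fin.cons X₀ X : Fin (n + 1) → ℂ) (Fin.cons Y₀ Y : Fin (n + 1) → ℂ)
        (Fin.cons j m : Fin (n + 1) → ℕ)
      = multiHead q (x * y ^ 2) b c d X₀ Y₀ X Y j
        * multiTerm q x (y * (q ^ j)⁻¹) (b * (q ^ j)⁻¹) (c * (q ^ j)⁻¹) (d * (q ^ j)⁻¹)
          (fun i => X i * (q ^ j)⁻¹) (fun i => Y i * (q ^ j)⁻¹) m := by
  have hj : q ^ j ≠ 0 := pow_ne_zero j hq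
  have e1 : ∀ X : ℂ, q * (X * (q ^ j)⁻¹) / (x * (y * (q ^ j)⁻¹) ^ 2)
      = q * X / (x * y ^ 2) * q ^ j := by intro X; field_simp
  have e2 : ∀ X : ℂ, q / (X * (q ^ j)⁻¹) = q / X * q ^ j := by intro X; field_simp
  have e3 : ∀ X Y : ℂ, X * (q ^ j)⁻¹ * (Y * (q ^ j)⁻¹) / (x * (y * (q ^ j)⁻¹) ^ 2)
      = X * Y / (x * y ^ 2) := by intro X Y; field_simp
  have e4 : q ^ 2 * (x * (y * (q ^ j)⁻¹) ^ 2) / (b * (q ^ j)⁻¹ * (c * (q ^ j)⁻¹) * (d * (q ^ j)⁻¹))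
      = q ^ 2 * (x * y ^ 2) / (b * c * d) * q ^ j := by field_simp
  have hsum : ∑ i, (Fin.cons j m : Fin (n + 1) → ℕ) i = j + ∑ i, m i := by
    simp [Fin.sum_univ_succ]
  rw [multiTerm_eq, multiTerm_eq, hsum, Fin.prod_univ_succ]
  simp only [partialSum_cons_zero, partialSum_cons_succ, partialSumBefore_zero,
    partialSumBefore_cons_succ, Fin.cons_zero, Fin.cons_succ, e1, e2, e3, e4, multiHead,
    qPoch_add, qPoch_zero, pow_zero, mul_one, pow_add]
  have : ∀ s : Fin n, qPoch q (X s * Y s / (x * y ^ 2)) (m s) / qPoch q q (m s)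
        / (qPoch q (q * X s / (x * y ^ 2)) j
            * qPoch q (q * X s / (x * y ^ 2) * q ^ j) (partialSum m s)
          * (qPoch q (q * Y s / (x * y ^ 2)) j
            * qPoch q (q * Y s / (x * y ^ 2) * q ^ j) (partialSum m s)))
        * (qPoch q (q / X s) j * qPoch q (q / X s * q ^ j) (partialSumBefore m s)
          * (qPoch q (q / Y s) j * qPoch q (q / Y s * q ^ j) (partialSumBefore m s))
          * ((X s * Y s / (x * y ^ 2)) ^ j * (X s * Y s / (x * y ^ 2)) ^ partialSumBefore m s))
      = (qPoch q (q / X s) j * qPoch q (q / Y s) j * (X s * Y s / (x * y ^ 2)) ^ j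
          / (qPoch q (q * X s / (x * y ^ 2)) j * qPoch q (q * Y s / (x * y ^ 2)) j))
        * (qPoch q (X s * Y s / (x * y ^ 2)) (m s) / qPoch q q (m s)
          / (qPoch q (q * X s / (x * y ^ 2) * q ^ j) (partialSum m s)
            * qPoch q (q * Y s / (x * y ^ 2) * q ^ j) (partialSum m s))
          * (qPoch q (q / X s * q ^ j) (partialSumBefore m s)
            * qPoch q (q / Y s * q ^ j) (partialSumBefore m s)
            * (X s * Y s / (x * y ^ 2)) ^ partialSumBefore m s)) := by
    intro s; simp only [div_eq_mul_inv, mul_inv]; ring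
  rw [Finset.prod_congr rfl fun s _ => this s, Finset.prod_mul_distrib]
  simp only [div_eq_mul_inv, mul_inv]
  ring

theorem qPoch_eq_zero_of_inv_pow {q : ℂ} (hq : q ≠ 0) {N m : ℕ} (h : N < m) :
    qPoch q (q ^ N)⁻¹ m = 0 := by
  refine Finset.prod_eq_zero (Finset.mem_range.2 h) ?_
  rw [inv_mul_cancel₀ (pow_ne_zero N hq), sub_self]

theorem multiTerm_eq_zero {n : ℕ} {q x y : ℂ} (hq : q ≠ 0) (b c d : ℂ) {X Y : Fin n → ℂ}
    {N : Fin n → ℕ} (hXY : ∀ i, x * y ^ 2 / (X i * Y i) = q ^ N i) {m : Fin n → ℕ} {s : Fin n}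
    (h : N s < m s) : multiTerm q x y b c d X Y m = 0 := by
  refine Finset.prod_eq_zero (Finset.mem_univ s) ?_
  rw [← inv_div (x * y ^ 2), hXY, qPoch_eq_zero_of_inv_pow hq h]
  simp

theorem finite_support_multiTerm {n : ℕ} {q x y : ℂ} (hq : q ≠ 0) (b c d : ℂ) {X Y : Fin n → ℂ}
    {N : Fin n → ℕ} (hXY : ∀ i, x * y ^ 2 / (X i * Y i) = q ^ N i) :
    (Function.support (multiTerm q x y b c d X Y)).Finite := by
  refine (Set.finite_Iic N).subset fun m hm s => ?_
  by_contra hs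
  exact hm (multiTerm_eq_zero hq b c d hXY (not_le.1 hs))

/-! ### Behaviour of the constants under the shift by `q^{-j}`. -/

theorem sq_pow_triangle (q : ℂ) (j : ℕ) : (q ^ (j * (j + 1) / 2)) ^ 2 = q ^ j ^ 2 * q ^ j := by
  rw [← pow_mul, Nat.div_mul_cancel (Nat.even_mul_succ_self j).two_dvd, ← pow_add]
  congr 1; ring

/-- The product `(X q^{-j}; q)_{j+N}` is split after `j` and after `N` factors, and the blocks of
length `j` are reversed; `X q^N = e/Y` turns the second one into a factorial in `Y`. -/
theorem qPoch_shift_left {q X Y e : ℂ} (hq : q ≠ 0) (hX : X ≠ 0) (hY : Y ≠ 0) (he : e ≠ 0)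
    {N : ℕ} (h : e / (X * Y) = q ^ N) (j : ℕ) :
    qPoch q X N * qPoch q (q / X) j * (X * Y / e) ^ j
      = qPoch q (X * (q ^ j)⁻¹) N * qPoch q (q * Y / e) j := by
  have hj : q ^ j ≠ 0 := pow_ne_zero j hq
  have hw : q ^ (j * (j + 1) / 2) ≠ 0 := pow_ne_zero _ hq
  have r1 := qPoch_reflect hq hX j
  have r2 := qPoch_reflect hq (div_ne_zero he hY) j
  rw [show q / (e / Y) = q * Y / e by field_simp] at r2
  have a1 := qPoch_add q (X * (q ^ j)⁻¹) j N
  have a2 := qPoch_add q (X * (q ^ j)⁻¹) N j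
  rw [inv_mul_cancel_right₀ hj] at a1
  rw [show X * (q ^ j)⁻¹ * q ^ N = e / Y * (q ^ j)⁻¹ by rw [← h]; field_simp, add_comm, a1] at a2
  have hne : (-(e / Y)) ^ j ≠ 0 := pow_ne_zero _ (neg_ne_zero.2 (div_ne_zero he hY))
  refine mul_right_cancel₀ hne ?_
  have e1 : (X * Y / e) ^ j * (-(e / Y)) ^ j = (-X) ^ j := by
    rw [← mul_pow]; congr 1; field_simp
  calc _ = qPoch q X N * qPoch q (q / X) j * ((X * Y / e) ^ j * (-(e / Y)) ^ j) := by ring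
    _ = qPoch q X N * ((-X) ^ j * qPoch q (q / X) j) := by rw [e1]; ring
    _ = (qPoch q (X * (q ^ j)⁻¹) j * qPoch q X N) * q ^ (j * (j + 1) / 2) := by rw [← r1]; ring
    _ = qPoch q (X * (q ^ j)⁻¹) N * (qPoch q (e / Y * (q ^ j)⁻¹) j * q ^ (j * (j + 1) / 2)) := by
      rw [a2]; ring
    _ = _ := by rw [r2]; ring

theorem qPoch_shift_right {q X Y e : ℂ} (hX : X ≠ 0) (hY : Y ≠ 0) (he : e ≠ 0)
    {N : ℕ} (h : e / (X * Y) = q ^ N) (j : ℕ) :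
    qPoch q (q * X / e) N * qPoch q (q / Y) j
      = qPoch q (q * X / e) j * qPoch q (q * X / e * q ^ j) N := by
  rw [← qPoch_add, add_comm, qPoch_add]
  congr 2
  rw [← h]; field_simp

theorem qPochInf_shift {q a : ℂ} (hq : q ≠ 0) (hq1 : ‖q‖ < 1) (ha : a ≠ 0) (j : ℕ) :
    qPochInf q (a * (q ^ j)⁻¹) * q ^ (j * (j + 1) / 2)
      = (-a) ^ j * qPoch q (q / a) j * qPochInf q a := by
  rw [qPochInf_eq_mul hq1 (a * (q ^ j)⁻¹) j, inv_mul_cancel_right₀ (pow_ne_zero j hq),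
    ← qPoch_reflect hq ha]
  ring

/-- Applied to `a = bcd/(q x y²)`, this shows that the convergence condition by itself keeps the
denominator with `q² x y²/(bcd)` from vanishing. -/
theorem qPoch_ne_zero_of_shift {q a : ℂ} (hq : q ≠ 0) (hq1 : ‖q‖ < 1) (ha : a ≠ 0) (j : ℕ)
    (h : ‖a * (q ^ j)⁻¹‖ < 1) : qPoch q (q / a) j ≠ 0 := by
  intro h0
  have := qPochInf_shift hq hq1 ha j
  rw [h0, mul_zero, zero_mul] at this
  exact mul_ne_zero (qPochInf_ne_zero_of_norm_lt hq1 h) (pow_ne_zero _ hq) this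

theorem qPochInf_triple_shift {q b c d e : ℂ} (hq : q ≠ 0) (hq1 : ‖q‖ < 1) (hb : b ≠ 0)
    (hc : c ≠ 0) (hd : d ≠ 0) (he : e ≠ 0) (j : ℕ)
    (h : ‖b * c * d / (q * e) * (q ^ j)⁻¹‖ < 1) :
    qPochInf q b * qPochInf q c * qPochInf q d / qPochInf q (b * c * d / (q * e))
        * (qPoch q (q / b) j * qPoch q (q / c) j * qPoch q (q / d) j
          / qPoch q (q ^ 2 * e / (b * c * d)) j) * (e ^ j * (q ^ j ^ 2)⁻¹)
      = qPochInf q (b * (q ^ j)⁻¹) * qPochInf q (c * (q ^ j)⁻¹) * qPochInf q (d * (q ^ j)⁻¹)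
        / qPochInf q (b * c * d / (q * e) * (q ^ j)⁻¹) := by
  have hD : b * c * d / (q * e) ≠ 0 := by positivity
  have hp := qPoch_ne_zero_of_shift hq hq1 hD j h
  have hi := qPochInf_ne_zero_of_norm_lt hq1 h
  have s1 := qPochInf_shift hq hq1 hb j
  have s2 := qPochInf_shift hq hq1 hc j
  have s3 := qPochInf_shift hq hq1 hd j
  have s4 := qPochInf_shift hq hq1 hD j
  have hw : q ^ (j * (j + 1) / 2) ≠ 0 := pow_ne_zero _ hq
  have hi' : qPochInf q (b * c * d / (q * e)) ≠ 0 := by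
    intro h0; rw [h0, mul_zero] at s4; exact mul_ne_zero hi hw s4
  have eD : q ^ 2 * e / (b * c * d) = q / (b * c * d / (q * e)) := by field_simp
  rw [eD]
  have hw2 := sq_pow_triangle q j
  generalize q ^ (j * (j + 1) / 2) = w at *
  have g1 := eq_div_of_mul_eq hw s1
  have g2 := eq_div_of_mul_eq hw s2
  have g3 := eq_div_of_mul_eq hw s3
  have g4 := eq_div_of_mul_eq hw s4
  rw [g1, g2, g3, g4]
  have e1 : (-b) ^ j * (-c) ^ j * (-d) ^ j = (-(b * c * d / (q * e))) ^ j * (e ^ j * q ^ j) := by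
    rw [← mul_pow, ← mul_pow, ← mul_pow, ← mul_pow]; congr 1; field_simp
  have hDj : (-(b * c * d / (q * e))) ^ j ≠ 0 := pow_ne_zero _ (neg_ne_zero.2 hD)
  have hj : q ^ j ≠ 0 := pow_ne_zero _ hq
  have hj2 : q ^ j ^ 2 ≠ 0 := pow_ne_zero _ hq
  generalize (-(b * c * d / (q * e))) ^ j = δ at *
  generalize qPoch q (q / (b * c * d / (q * e))) j = p at *
  generalize qPochInf q (b * c * d / (q * e)) = P at *
  field_simp
  linear_combination (qPochInf q b * qPochInf q c * qPochInf q d * qPoch q (q / b) j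
    * qPoch q (q / c) j * qPoch q (q / d) j) * (δ * e ^ j * hw2 - q ^ j ^ 2 * e1)

/-- Reversing the last `j` factors of `(q; q)_N` and `(X; q)_N` turns the Saalschütz coefficient
into the form it has in the multiple sum, where `X Y / e = q^{-N}`. The trailing power of `e` and
`q` cancels the one in `qPochInf_triple_shift`. -/
theorem shiftCoeff_eq {q X Y e : ℂ} (hq : q ≠ 0) (hq1 : ‖q‖ < 1) (hX : X ≠ 0) (hY : Y ≠ 0)
    (he : e ≠ 0) {N : ℕ} (h : e / (X * Y) = q ^ N) {j : ℕ} (hj : j ≤ N)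
    (hpX : qPoch q (q * X / e) j ≠ 0) (hpY : qPoch q (q * Y / e) j ≠ 0) :
    shiftCoeff q e X N j = qPoch q X N * qPoch q (q * X / e) N
      * (qPoch q (X * Y / e) j / qPoch q q j / (qPoch q (q * X / e) j * qPoch q (q * Y / e) j))
      * q ^ j * ((e ^ j)⁻¹ * q ^ j ^ 2) := by
  obtain ⟨i, rfl⟩ := Nat.exists_eq_add_of_le hj
  have hqj : q ^ j ≠ 0 := pow_ne_zero j hq
  have hw : q ^ (j * (j + 1) / 2) ≠ 0 := pow_ne_zero _ hq
  have hqi : q ^ (j + i + 1) ≠ 0 := pow_ne_zero _ hq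
  have r1 := qPoch_reflect hq (div_ne_zero he hY) j
  have r2 := qPoch_reflect hq hqi j
  have t1 : e / Y * (q ^ j)⁻¹ = X * q ^ i := by
    have : e / Y = X * q ^ (j + i) := by rw [← h]; field_simp
    rw [this, pow_add]; field_simp
  have t2 : q / (e / Y) = q * Y / e := by field_simp
  have t3 : q ^ (j + i + 1) * (q ^ j)⁻¹ = q * q ^ i := by
    rw [pow_succ, pow_add]; field_simp
  have t4 : q / q ^ (j + i + 1) = X * Y / e := by
    rw [pow_succ, ← h]; field_simp
  rw [t1, t2] at r1
  rw [t3, t4] at r2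
  have a1 : qPoch q X (j + i) = qPoch q X i * qPoch q (X * q ^ i) j := by rw [add_comm, qPoch_add]
  have a2 : qPoch q q (j + i) = qPoch q q i * qPoch q (q * q ^ i) j := by rw [add_comm, qPoch_add]
  rw [shiftCoeff, Nat.add_sub_cancel_left, a1, a2, qPoch_add q (q * X / e)]
  have g1 := eq_div_of_mul_eq hw r1
  have g2 := eq_div_of_mul_eq hw r2
  rw [g1, g2]
  have e1 : (-q ^ (j + i + 1)) ^ j * X ^ j = (-(e / Y)) ^ j * q ^ j := by
    rw [← mul_pow, ← mul_pow]; congr 1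
    have : e / Y = X * q ^ (j + i) := by rw [← h]; field_simp
    rw [this]; ring
  have hi := qPoch_self_ne_zero hq1 i
  have hjj := qPoch_self_ne_zero hq1 j
  have hej : e ^ j ≠ 0 := pow_ne_zero _ he
  generalize (-q ^ (j + i + 1)) ^ j = δ at *
  generalize (-(e / Y)) ^ j = δ' at *
  generalize q ^ (j * (j + 1) / 2) = w at *
  generalize qPoch q (q * X / e) j = p₁ at *
  generalize qPoch q (q * Y / e) j = p₂ at *
  generalize qPoch q (X * Y / e) j = p₃ at *
  generalize qPoch q (q * X / e * q ^ j) i = p₄ at *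
  field_simp
  linear_combination p₃ * p₄ * qPoch q X i * e1

/-! ### Evaluation of the bilateral sum by induction on `n`. -/

/-- The bilateral summand: a `₆ψ₆` term times a polynomial factor for each pair of parameters. -/
noncomputable def psiSummand {n : ℕ} (q x y b c d : ℂ) (X : Fin n → ℂ) (N : Fin n → ℕ) (k : ℤ) :
    ℂ :=
  psiTerm q (q / x) (x * y) (b / y) (c / y) (d / y) k
    * ∏ i, (qPoch q (X i / y * q ^ (-k)) (N i) * qPoch q (q / x * (X i / y) * q ^ k) (N i))

/-- The factor in front of the multiple sum in the evaluation of `∑ psiSummand`. -/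
noncomputable def psiConst {n : ℕ} (q x e b c d : ℂ) (X : Fin n → ℂ) (N : Fin n → ℕ) : ℂ :=
  qPochInf q q * qPochInf q (q / x) * qPochInf q x
    * (qPochInf q (b * c / e) * qPochInf q (b * d / e) * qPochInf q (c * d / e))
    * (qPochInf q b * qPochInf q c * qPochInf q d / qPochInf q (b * c * d / (q * e)))
    * ∏ i, (qPoch q (X i) (N i) * qPoch q (q * X i / e) (N i))

/-- The ratios `b/y`, `c/y`, `d/y`, `X i/y` stay fixed while `y` becomes `y q^{-j}`, so `b, c, d`
and the remaining `X i` must be shifted too. -/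
theorem psiSummand_cons {n : ℕ} {q x y : ℂ} (hq : q ≠ 0) (hq1 : ‖q‖ < 1) (hx : x ≠ 0)
    (hy : y ≠ 0) (b c d X₀ : ℂ) (X : Fin n → ℂ) (N₀ : ℕ) (N : Fin n → ℕ) (k : ℤ) :
    psiSummand q x y b c d (Fin.cons X₀ X : Fin (n + 1) → ℂ) (Fin.cons N₀ N : Fin (n + 1) → ℕ) k
      = ∑ j ∈ Finset.range (N₀ + 1), shiftCoeff q (x * y ^ 2) X₀ N₀ j
        * psiSummand q x (y * (q ^ j)⁻¹) (b * (q ^ j)⁻¹) (c * (q ^ j)⁻¹) (d * (q ^ j)⁻¹)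
          (fun i => X i * (q ^ j)⁻¹) N k := by
  have hs : ∀ (a : ℂ) (j : ℕ), a * (q ^ j)⁻¹ / (y * (q ^ j)⁻¹) = a / y := fun a j =>
    mul_div_mul_right _ _ (inv_ne_zero (pow_ne_zero j hq))
  simp only [psiSummand, hs, Fin.prod_univ_succ, Fin.cons_zero, Fin.cons_succ]
  rw [← mul_assoc, psiTerm_mul_expand hq hq1 hx hy, Finset.sum_mul]
  exact Finset.sum_congr rfl fun j _ => by ring

theorem psiConst_mul_multiHead {n : ℕ} {q x e b c d X₀ Y₀ : ℂ} {X Y : Fin n → ℂ} {N₀ : ℕ}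
    {N : Fin n → ℕ} (hq : q ≠ 0) (hq1 : ‖q‖ < 1) (hb : b ≠ 0) (hc : c ≠ 0) (hd : d ≠ 0)
    (he : e ≠ 0) (hX₀ : X₀ ≠ 0) (hY₀ : Y₀ ≠ 0) (hX : ∀ i, X i ≠ 0) (hY : ∀ i, Y i ≠ 0)
    (h₀ : e / (X₀ * Y₀) = q ^ N₀) (h : ∀ i, e / (X i * Y i) = q ^ N i)
    {j : ℕ} (hj : j ≤ N₀)
    (hpX₀ : qPoch q (q * X₀ / e) j ≠ 0) (hpY₀ : qPoch q (q * Y₀ / e) j ≠ 0)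
    (hpX : ∀ i, qPoch q (q * X i / e) j ≠ 0) (hpY : ∀ i, qPoch q (q * Y i / e) j ≠ 0)
    (hD : ‖b * c * d / (q * e) * (q ^ j)⁻¹‖ < 1) :
    psiConst q x e b c d (Fin.cons X₀ X : Fin (n + 1) → ℂ) (Fin.cons N₀ N : Fin (n + 1) → ℕ)
        * multiHead q e b c d X₀ Y₀ X Y j
      = shiftCoeff q e X₀ N₀ j * psiConst q x (e * ((q ^ j)⁻¹) ^ 2) (b * (q ^ j)⁻¹)
        (c * (q ^ j)⁻¹) (d * (q ^ j)⁻¹) (fun i => X i * (q ^ j)⁻¹) N := by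
  have hqj : q ^ j ≠ 0 := pow_ne_zero j hq
  have c1 : ∀ b c : ℂ, b * (q ^ j)⁻¹ * (c * (q ^ j)⁻¹) / (e * ((q ^ j)⁻¹) ^ 2) = b * c / e := by
    intro b c; field_simp
  have c2 : b * (q ^ j)⁻¹ * (c * (q ^ j)⁻¹) * (d * (q ^ j)⁻¹) / (q * (e * ((q ^ j)⁻¹) ^ 2))
      = b * c * d / (q * e) * (q ^ j)⁻¹ := by field_simp
  have c3 : ∀ X : ℂ, q * (X * (q ^ j)⁻¹) / (e * ((q ^ j)⁻¹) ^ 2) = q * X / e * q ^ j := by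
    intro X; field_simp
  have t := qPochInf_triple_shift hq hq1 hb hc hd he j hD
  have p : ∀ i, qPoch q (X i * (q ^ j)⁻¹) (N i) * qPoch q (q * X i / e * q ^ j) (N i)
      = qPoch q (X i) (N i) * qPoch q (q * X i / e) (N i)
        * (qPoch q (q / X i) j * qPoch q (q / Y i) j * (X i * Y i / e) ^ j
          / (qPoch q (q * X i / e) j * qPoch q (q * Y i / e) j)) := by
    intro i
    have l1 := qPoch_shift_left hq (hX i) (hY i) he (h i) j
    have l2 := qPoch_shift_right (hX i) (hY i) he (h i) j
    have l1' := eq_div_of_mul_eq (hpY i) l1.symm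
    have l2' := eq_div_of_mul_eq (hpX i) ((mul_comm _ _).trans l2.symm)
    rw [l1', l2']
    simp only [div_eq_mul_inv, mul_inv]
    ring
  have hej : e ^ j * (q ^ j ^ 2)⁻¹ * ((e ^ j)⁻¹ * q ^ j ^ 2) = 1 := by
    have h1 : e ^ j ≠ 0 := pow_ne_zero _ he
    have h2 : q ^ j ^ 2 ≠ 0 := pow_ne_zero _ hq
    field_simp
  rw [shiftCoeff_eq hq hq1 hX₀ hY₀ he h₀ hj hpX₀ hpY₀, psiConst, psiConst, multiHead]
  simp only [Fin.prod_univ_succ, Fin.cons_zero, Fin.cons_succ, c1, c2, c3]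
  rw [← t, Finset.prod_congr rfl fun i _ => p i, Finset.prod_mul_distrib
    (f := fun i => qPoch q (X i) (N i) * qPoch q (q * X i / e) (N i))]
  generalize ∏ i, qPoch q (X i) (N i) * qPoch q (q * X i / e) (N i) = A
  generalize ∏ i, qPoch q (q / X i) j * qPoch q (q / Y i) j * (X i * Y i / e) ^ j
          / (qPoch q (q * X i / e) j * qPoch q (q * Y i / e) j) = B
  generalize qPochInf q b * qPochInf q c * qPochInf q d / qPochInf q (b * c * d / (q * e)) = C
  generalize qPoch q (q / b) j * qPoch q (q / c) j * qPoch q (q / d) j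
          / qPoch q (q ^ 2 * e / (b * c * d)) j = D
  generalize qPoch q (X₀ * Y₀ / e) j / qPoch q q j
    / (qPoch q (q * X₀ / e) j * qPoch q (q * Y₀ / e) j) = E
  linear_combination -(qPochInf q q * qPochInf q (q / x) * qPochInf q x
    * (qPochInf q (b * c / e) * qPochInf q (b * d / e) * qPochInf q (c * d / e))
    * A * B * C * D * E * qPoch q X₀ N₀ * qPoch q (q * X₀ / e) N₀ * q ^ j) * hej

theorem tsum_multiTerm_cons {n : ℕ} {q x y : ℂ} (hq : q ≠ 0) (b c d : ℂ) {X₀ Y₀ : ℂ}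
    {X Y : Fin n → ℂ} {N₀ : ℕ} {N : Fin n → ℕ} (h₀ : x * y ^ 2 / (X₀ * Y₀) = q ^ N₀)
    (hXY : ∀ i, x * y ^ 2 / (X i * Y i) = q ^ N i) :
    ∑' m, multiTerm q x y b c d (Fin.cons X₀ X : Fin (n + 1) → ℂ)
        (Fin.cons Y₀ Y : Fin (n + 1) → ℂ) m
      = ∑ j ∈ Finset.range (N₀ + 1), multiHead q (x * y ^ 2) b c d X₀ Y₀ X Y j
        * ∑' m, multiTerm q x (y * (q ^ j)⁻¹) (b * (q ^ j)⁻¹) (c * (q ^ j)⁻¹) (d * (q ^ j)⁻¹)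
          (fun i => X i * (q ^ j)⁻¹) (fun i => Y i * (q ^ j)⁻¹) m := by
  have hXY' : ∀ i : Fin (n + 1), x * y ^ 2 / ((Fin.cons X₀ X : Fin (n + 1) → ℂ) i
      * (Fin.cons Y₀ Y : Fin (n + 1) → ℂ) i) = q ^ (Fin.cons N₀ N : Fin (n + 1) → ℕ) i :=
    Fin.cases h₀ hXY
  have hs : Summable (multiTerm q x y b c d (Fin.cons X₀ X : Fin (n + 1) → ℂ)
      (Fin.cons Y₀ Y : Fin (n + 1) → ℂ)) :=
    summable_of_hasFiniteSupport (finite_support_multiTerm hq b c d hXY')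
  rw [← (Fin.consEquiv fun _ : Fin (n + 1) => ℕ).summable_iff] at hs
  rw [← (Fin.consEquiv fun _ : Fin (n + 1) => ℕ).tsum_eq]
  have e : ∀ j : ℕ, ∑' m : Fin n → ℕ, multiTerm q x y b c d (Fin.cons X₀ X : Fin (n + 1) → ℂ)
        (Fin.cons Y₀ Y : Fin (n + 1) → ℂ) (Fin.consEquiv (fun _ : Fin (n + 1) => ℕ) (j, m))
      = multiHead q (x * y ^ 2) b c d X₀ Y₀ X Y j
        * ∑' m, multiTerm q x (y * (q ^ j)⁻¹) (b * (q ^ j)⁻¹) (c * (q ^ j)⁻¹) (d * (q ^ j)⁻¹)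
          (fun i => X i * (q ^ j)⁻¹) (fun i => Y i * (q ^ j)⁻¹) m := by
    intro j
    rw [← tsum_mul_left]
    exact tsum_congr fun m => multiTerm_cons hq x y b c d X₀ Y₀ X Y j m
  refine (hs.tsum_prod.trans (tsum_congr e)).trans (tsum_eq_sum fun j hj => ?_)
  have : N₀ < j := by simpa using hj
  rw [multiHead, ← inv_div (x * y ^ 2), h₀, qPoch_eq_zero_of_inv_pow hq this]
  simp

theorem hasSum_psiSummand {n : ℕ} {q x : ℂ} (hq : q ≠ 0) (hq1 : ‖q‖ < 1) (hx : x ≠ 0)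
    {y b c d : ℂ} (hy : y ≠ 0) (hb : b ≠ 0) (hc : c ≠ 0) (hd : d ≠ 0)
    {X Y : Fin n → ℂ} {N : Fin n → ℕ} (hXY : ∀ i, x * y ^ 2 / (X i * Y i) = q ^ N i)
    (hconv : ‖b * c * d / (x * y ^ 2 * q ^ ((∑ i, N i) + 1))‖ < 1)
    (hdenM : ∀ s, ∀ u ∈ [q * X s / (x * y ^ 2), q * Y s / (x * y ^ 2)],
      ∀ j < partialSum N s, 1 - u * q ^ j ≠ 0) :
    HasSum (psiSummand q x y b c d X N)
      (psiConst q x (x * y ^ 2) b c d X N * ∑' m, multiTerm q x y b c d X Y m) := by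
  induction n generalizing y b c d with
  | zero =>
    have hD : (q / x) ^ 2 * (x * y * (b / y) * (c / y) * (d / y)) / q ^ 3
        = b * c * d / (q * (x * y ^ 2)) := by field_simp
    have h1 : ‖(q / x) ^ 2 * (x * y * (b / y) * (c / y) * (d / y)) / q ^ 3‖ < 1 := by
      rw [hD, mul_comm q]; simpa using hconv
    have ha : q / x ≠ 0 := div_ne_zero hq hx
    have h2 := (summable_psiTerm hq hq1 ha h1).hasSum
    rw [tsum_psiTerm hq hq1 ha h1, hD] at h2
    have e1 : ∀ b : ℂ, q / x * (x * y) * (b / y) / q = b := by intro b; field_simp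
    have e2 : ∀ b c : ℂ, q / x * (b / y) * (c / y) / q = b * c / (x * y ^ 2) := by
      intro b c; field_simp
    have e3 : q / (q / x) = x := by field_simp
    simp only [e1, e2, e3] at h2
    have e4 : psiSummand q x y b c d X N
        = psiTerm q (q / x) (x * y) (b / y) (c / y) (d / y) := by
      ext k; simp [psiSummand]
    rw [e4]
    convert h2 using 1
    simp only [psiConst, multiTerm, Finset.univ_eq_empty, Finset.prod_empty, mul_one]
    rw [tsum_eq_single (0 : Fin 0 → ℕ) (fun m hm => (hm (Subsingleton.elim _ _)).elim)]
    ring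
  | succ n ih =>
    obtain ⟨X₀, X, rfl⟩ : ∃ X₀ X', X = Fin.cons X₀ X' := ⟨X 0, Fin.tail X, by simp⟩
    obtain ⟨Y₀, Y, rfl⟩ : ∃ Y₀ Y', Y = Fin.cons Y₀ Y' := ⟨Y 0, Fin.tail Y, by simp⟩
    obtain ⟨N₀, N, rfl⟩ : ∃ N₀ N', N = Fin.cons N₀ N' := ⟨N 0, Fin.tail N, by simp⟩
    have he : x * y ^ 2 ≠ 0 := by positivity
    have h₀ : x * y ^ 2 / (X₀ * Y₀) = q ^ N₀ := hXY 0
    have h : ∀ i, x * y ^ 2 / (X i * Y i) = q ^ N i := fun i => hXY i.succ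
    have hne : ∀ (u v : ℂ) (M : ℕ), x * y ^ 2 / (u * v) = q ^ M → u ≠ 0 ∧ v ≠ 0 := by
      intro u v M huv
      have : u * v ≠ 0 := by
        intro h0; rw [h0, div_zero] at huv; exact pow_ne_zero M hq huv.symm
      exact ⟨left_ne_zero_of_mul this, right_ne_zero_of_mul this⟩
    have hd0 : ∀ u ∈ [q * X₀ / (x * y ^ 2), q * Y₀ / (x * y ^ 2)],
        ∀ j < N₀, 1 - u * q ^ j ≠ 0 := by
      have := hdenM 0; rwa [partialSum_cons_zero] at this
    have hds : ∀ s, ∀ u ∈ [q * X s / (x * y ^ 2), q * Y s / (x * y ^ 2)],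
        ∀ j < N₀ + partialSum N s, 1 - u * q ^ j ≠ 0 := by
      intro s
      have := hdenM s.succ
      rwa [partialSum_cons_succ] at this
    rw [tsum_multiTerm_cons hq b c d h₀ h, Finset.mul_sum]
    have hsum : ∑ i, (Fin.cons N₀ N : Fin (n + 1) → ℕ) i = N₀ + ∑ i, N i := by
      simp [Fin.sum_univ_succ]
    rw [hsum] at hconv
    have hfun : psiSummand q x y b c d (Fin.cons X₀ X : Fin (n + 1) → ℂ)
        (Fin.cons N₀ N : Fin (n + 1) → ℕ) = fun k => ∑ j ∈ Finset.range (N₀ + 1),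
          shiftCoeff q (x * y ^ 2) X₀ N₀ j * psiSummand q x (y * (q ^ j)⁻¹) (b * (q ^ j)⁻¹)
            (c * (q ^ j)⁻¹) (d * (q ^ j)⁻¹) (fun i => X i * (q ^ j)⁻¹) N k :=
      funext fun k => psiSummand_cons hq hq1 hx hy b c d X₀ X N₀ N k
    rw [hfun]
    refine hasSum_sum fun j hj => ?_
    have hjN : j ≤ N₀ := Nat.lt_succ_iff.1 (Finset.mem_range.1 hj)
    have hqj : q ^ j ≠ 0 := pow_ne_zero j hq
    have hqi : (q ^ j)⁻¹ ≠ 0 := inv_ne_zero hqj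
    -- Lowering the exponent of `q` in the denominator only shrinks the norm. `M = j` serves the
    -- present step and `M = j + ∑ N i` the induction hypothesis.
    have hnorm : ∀ M, j ≤ M → M ≤ N₀ + ∑ i, N i →
        ‖b * c * d / (x * y ^ 2 * q ^ (M + 1))‖ < 1 := by
      intro M _ hM
      obtain ⟨l, hl⟩ := Nat.exists_eq_add_of_le hM
      have := norm_mul_pow_lt hq1 hconv l
      rw [hl] at this
      convert this using 2
      rw [show M + l + 1 = (M + 1) + l by ring, pow_add q (M + 1)]
      field_simp
    have hD : ‖b * c * d / (q * (x * y ^ 2)) * (q ^ j)⁻¹‖ < 1 := by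
      have := hnorm j le_rfl (by omega)
      convert this using 2
      rw [pow_succ q j]; field_simp
    have hsh : x * (y * (q ^ j)⁻¹) ^ 2 = x * y ^ 2 * ((q ^ j)⁻¹) ^ 2 := by ring
    rw [← mul_assoc, psiConst_mul_multiHead hq hq1 hb hc hd he (hne _ _ _ h₀).1 (hne _ _ _ h₀).2
      (fun i => (hne _ _ _ (h i)).1) (fun i => (hne _ _ _ (h i)).2) h₀ h hjN
      (qPoch_ne_zero fun i hi => hd0 _ (by simp) i (by omega))
      (qPoch_ne_zero fun i hi => hd0 _ (by simp) i (by omega))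
      (fun s => qPoch_ne_zero fun i hi => hds s _ (by simp) i (by omega))
      (fun s => qPoch_ne_zero fun i hi => hds s _ (by simp) i (by omega)) hD, mul_assoc, ← hsh]
    refine HasSum.mul_left _ (ih (mul_ne_zero hy hqi) (mul_ne_zero hb hqi) (mul_ne_zero hc hqi)
      (mul_ne_zero hd hqi) (fun i => ?_) ?_ ?_)
    · rw [← h i]; field_simp
    · have := hnorm (j + ∑ i, N i) (by omega) (by omega)
      convert this using 2
      rw [show j + ∑ i, N i + 1 = j + (∑ i, N i + 1) by ring, pow_add q j]
      field_simp
    · intro s u hu i hi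
      have e : ∀ X : ℂ, q * (X * (q ^ j)⁻¹) / (x * (y * (q ^ j)⁻¹) ^ 2) * q ^ i
          = q * X / (x * y ^ 2) * q ^ (j + i) := by
        intro X; rw [pow_add]; field_simp
      simp only [List.mem_cons, List.not_mem_nil, or_false] at hu
      rcases hu with rfl | rfl
      · rw [e]; exact hds s _ (by simp) _ (by omega)
      · rw [e]; exact hds s _ (by simp) _ (by omega)

/-! ### The two unilateral series as halves of the bilateral one. -/

theorem pow_triangle_succ (q : ℂ) (k : ℕ) :
    q ^ ((k + 1) * (k + 1 + 1) / 2) = q ^ (k * (k + 1) / 2) * q ^ (k + 1) := by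
  rw [← pow_add, ← Nat.add_mul_div_right _ _ two_pos]
  congr 2; ring

/-- The quotient of finite products of a pair of parameters with `Y = x y² q^{-N} / X`, written
as a polynomial factor; here `A = X / y`. -/
theorem qPoch_pair_quotient {q x A : ℂ} (hq : q ≠ 0) (hx : x ≠ 0) (hA : A ≠ 0) (N k : ℕ)
    (hu : qPoch q A (N + 1) ≠ 0) (hv : qPoch q (A / x) (N + 1) ≠ 0)
    (hg : qPoch q (A / x) (k + 1) ≠ 0) (hd : qPoch q (1 / (A * q ^ N)) (k + 1) ≠ 0) :
    qPoch q (A * (q ^ k)⁻¹) k * qPoch q (x / (A * q ^ N) * (q ^ k)⁻¹) k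
        / (qPoch q (A / x) (k + 1) * qPoch q (1 / (A * q ^ N)) (k + 1))
      = -A * q ^ N / (qPoch q A (N + 1) * qPoch q (A / x) (N + 1))
        * (qPoch q (A * (q ^ k)⁻¹) N * qPoch q (q / x * A * q ^ k) N)
        * (x ^ k * (q ^ (k * (k + 1)))⁻¹) := by
  have hqk : q ^ k ≠ 0 := pow_ne_zero k hq
  have hqN : q ^ N ≠ 0 := pow_ne_zero N hq
  have hw : q ^ (k * (k + 1) / 2) ≠ 0 := pow_ne_zero _ hq
  have r1 := qPoch_reflect hq (a := x / (A * q ^ N)) (by positivity) k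
  have r2 := qPoch_reflect hq (a := q ^ (k + 1) / (A * q ^ N)) (by positivity) (k + 1)
  rw [show q ^ (k + 1) / (A * q ^ N) * (q ^ (k + 1))⁻¹ = 1 / (A * q ^ N) by
      field_simp, show q / (q ^ (k + 1) / (A * q ^ N)) = A * (q ^ k)⁻¹ * q ^ N by
      rw [pow_succ]; field_simp, pow_triangle_succ] at r2
  -- Splitting `(A q^{-k}; q)_{k+N+1}` and `(A/x; q)_{k+N+1}` at two places each trades factorials
  -- of length about `k` for factorials of length about `N`.
  have a1 := qPoch_add q (A * (q ^ k)⁻¹) k (N + 1)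
  have a2 := qPoch_add q (A * (q ^ k)⁻¹) N (k + 1)
  rw [inv_mul_cancel_right₀ hqk, show k + (N + 1) = N + (k + 1) by ring, a2] at a1
  have a3 := qPoch_add q (A / x) (k + 1) N
  have a4 := qPoch_add q (A / x) (N + 1) k
  rw [show N + 1 + k = k + 1 + N by ring, a3, show A / x * q ^ (k + 1) = q / x * A * q ^ k by ring,
    show A / x * q ^ (N + 1) = q / (x / (A * q ^ N)) by rw [pow_succ]; field_simp] at a4
  have g1 := eq_div_of_mul_eq hu a1.symm
  have g2 := eq_div_of_mul_eq hv ((mul_comm _ _).trans a4.symm)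
  rw [g2] at r1
  have g3 := eq_div_of_mul_eq hw r1
  have hz : (-(q ^ (k + 1) / (A * q ^ N))) ^ (k + 1) ≠ 0 :=
    pow_ne_zero _ (neg_ne_zero.2 (by positivity))
  have g4 := eq_div_of_mul_eq hz ((mul_comm _ _).trans r2.symm)
  rw [g4] at g1
  rw [g1, g3]
  have e : (-(x / (A * q ^ N))) ^ k * q ^ (k + 1) * q ^ (k * (k + 1))
      = (-(q ^ (k + 1) / (A * q ^ N))) ^ (k + 1) * (-A * q ^ N * x ^ k) := by
    have e1 : q ^ (k * (k + 1)) = (q ^ (k + 1)) ^ k := by rw [← pow_mul]; congr 1; ring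
    have e2 : (-(x / (A * q ^ N))) ^ k * (q ^ (k + 1)) ^ k
        = (-(q ^ (k + 1) / (A * q ^ N))) ^ k * x ^ k := by
      rw [← mul_pow, ← mul_pow]; congr 1; ring
    rw [e1, pow_succ (-(q ^ (k + 1) / (A * q ^ N)))]
    have e3 : -(q ^ (k + 1) / (A * q ^ N)) * (-A * q ^ N) = q ^ (k + 1) := by field_simp
    linear_combination q ^ (k + 1) * e2
      - (-(q ^ (k + 1) / (A * q ^ N))) ^ k * x ^ k * e3
  have hkk : q ^ (k * (k + 1)) ≠ 0 := pow_ne_zero _ hq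
  have hq1 : q ^ (k + 1) ≠ 0 := pow_ne_zero _ hq
  generalize (-(x / (A * q ^ N))) ^ k = δ at *
  generalize (-(q ^ (k + 1) / (A * q ^ N))) ^ (k + 1) = δ' at *
  generalize qPoch q (A / x) (k + 1) = p₁ at *
  generalize qPoch q (A / x) (N + 1) = p₂ at *
  generalize qPoch q A (N + 1) = p₃ at *
  generalize qPoch q (1 / (A * q ^ N)) (k + 1) = p₄ at *
  generalize qPoch q (A * (q ^ k)⁻¹) N = p₅ at *
  generalize qPoch q (q / x * A * q ^ k) N = p₆ at *
  generalize q ^ (k * (k + 1)) = z at *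
  generalize q ^ (k * (k + 1) / 2) = w at *
  generalize q ^ (k + 1) = z' at *
  field_simp
  linear_combination p₅ * p₆ * e

theorem qPoch_single_quotient {q x B : ℂ} (hq : q ≠ 0) (hq1 : ‖q‖ < 1)
    (h1 : qPochInf q B ≠ 0) (h2 : qPochInf q (B / x) ≠ 0) (k : ℕ) :
    qPoch q (B * (q ^ k)⁻¹) k / qPoch q (B / x) (k + 1)
      = qPochInf q (B * q ^ (-(k : ℤ))) * qPochInf q (q / x * B * q ^ (k : ℤ))
        / (qPochInf q B * qPochInf q (B / x)) := by
  have a1 := qPochInf_eq_mul hq1 (B * (q ^ k)⁻¹) k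
  rw [inv_mul_cancel_right₀ (pow_ne_zero k hq)] at a1
  have a2 := qPochInf_eq_mul hq1 (B / x) (k + 1)
  rw [show B / x * q ^ (k + 1) = q / x * B * q ^ k by ring] at a2
  have h3 : qPoch q (B / x) (k + 1) ≠ 0 := fun h0 => h2 (by rw [a2, h0, zero_mul])
  have h4 : qPochInf q (q / x * B * q ^ k) ≠ 0 := fun h0 => h2 (by rw [a2, h0, mul_zero])
  rw [zpow_neg, zpow_natCast, a1, a2]
  generalize qPochInf q (q / x * B * q ^ k) = p at *
  field_simp

/-- The constant relating the two unilateral series to the bilateral one. -/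
noncomputable def bilateralConst {n : ℕ} (q x y b c d : ℂ) (X : Fin n → ℂ) (N : Fin n → ℕ) : ℂ :=
  (∏ i, -(X i / y) * q ^ N i / (qPoch q (X i / y) (N i + 1) * qPoch q (X i / (x * y)) (N i + 1)))
    / ((qPochInf q (x * y) * qPochInf q y) * (qPochInf q (b / y) * qPochInf q (b / (x * y)))
      * (qPochInf q (c / y) * qPochInf q (c / (x * y)))
      * (qPochInf q (d / y) * qPochInf q (d / (x * y))))

theorem firstTerm_eq {n : ℕ} {q x y b c d : ℂ} {X Y : Fin n → ℂ} {N : Fin n → ℕ}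
    (hq : q ≠ 0) (hq1 : ‖q‖ < 1) (hx : x ≠ 0) (hy : y ≠ 0)
    (hXY : ∀ i, x * y ^ 2 / (X i * Y i) = q ^ N i)
    (hden : ∀ u ∈ [y, x * y, b / y, c / y, d / y, b / (x * y), c / (x * y), d / (x * y)],
      ∀ j : ℕ, 1 - u * q ^ j ≠ 0)
    (hdenXY : ∀ i, ∀ u ∈ [X i / y, X i / (x * y), Y i / (x * y)], ∀ j : ℕ, 1 - u * q ^ j ≠ 0)
    (k : ℕ) :
    firstTerm q x y b c d X Y k
      = bilateralConst q x y b c d X N * psiSummand q x y b c d X N k := by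
  have hqk : q ^ k ≠ 0 := pow_ne_zero k hq
  have hinf : ∀ u ∈ [y, x * y, b / y, c / y, d / y, b / (x * y), c / (x * y), d / (x * y)],
      qPochInf q u ≠ 0 := fun u hu => qPochInf_ne_zero hq1 (hden u hu)
  have dxy : ∀ u : ℂ, u / (x * y) = u / y / x := fun u => by field_simp
  have single : ∀ u : ℂ, qPochInf q (u / y) ≠ 0 → qPochInf q (u / (x * y)) ≠ 0 →
      qPoch q ((q ^ k)⁻¹ * u / y) k / qPoch q (u / (x * y)) (k + 1)
        = qPochInf q (u / y * q ^ (-(k : ℤ))) * qPochInf q (q / x * (u / y) * q ^ (k : ℤ))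
          / (qPochInf q (u / y) * qPochInf q (u / (x * y))) := by
    intro u h1 h2
    rw [dxy] at h2 ⊢
    rw [← qPoch_single_quotient hq hq1 h1 h2, show (q ^ k)⁻¹ * u / y = u / y * (q ^ k)⁻¹ by ring]
  have f1 := single b (hinf _ (by simp)) (hinf _ (by simp))
  have f2 := single c (hinf _ (by simp)) (hinf _ (by simp))
  have f3 := single d (hinf _ (by simp)) (hinf _ (by simp))
  -- After reversal, the factorial of `q/(xy)` over that of `y` is a fourth quotient of the same
  -- kind, with `B = xy`; it supplies the parameter `b₀` of the ₆ψ₆ term.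
  have f0 := qPoch_single_quotient (x := x) (B := x * y) hq hq1 (hinf _ (by simp))
    (by rw [mul_div_cancel_left₀ y hx]; exact hinf _ (by simp)) k
  rw [mul_div_cancel_left₀ y hx] at f0
  have hxy : x * y ≠ 0 := mul_ne_zero hx hy
  have hr := qPoch_reflect hq hxy k
  have hr' : qPoch q (q / (x * y)) k
      = qPoch q (x * y * (q ^ k)⁻¹) k * q ^ (k * (k + 1) / 2) / (-(x * y)) ^ k :=
    eq_div_of_mul_eq (pow_ne_zero k (neg_ne_zero.2 hxy)) ((mul_comm _ _).trans hr.symm)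
  have fi : ∀ i, qPoch q ((q ^ k)⁻¹ * X i / y) k * qPoch q ((q ^ k)⁻¹ * Y i / y) k
      / (qPoch q (X i / (x * y)) (k + 1) * qPoch q (Y i / (x * y)) (k + 1))
      = -(X i / y) * q ^ N i / (qPoch q (X i / y) (N i + 1) * qPoch q (X i / (x * y)) (N i + 1))
        * (qPoch q (X i / y * q ^ (-(k : ℤ))) (N i)
          * qPoch q (q / x * (X i / y) * q ^ (k : ℤ)) (N i))
        * (x ^ k * (q ^ (k * (k + 1)))⁻¹) := by
    intro i
    have hqN : q ^ N i ≠ 0 := pow_ne_zero _ hq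
    have hXYi : X i * Y i ≠ 0 := by
      intro h0; have := hXY i; rw [h0, div_zero] at this; exact hqN this.symm
    have hX := left_ne_zero_of_mul hXYi
    have hY := right_ne_zero_of_mul hXYi
    have y1 : Y i / (x * y) = 1 / (X i / y * q ^ N i) := by rw [← hXY]; field_simp
    have y2 : (q ^ k)⁻¹ * Y i / y = x / (X i / y * q ^ N i) * (q ^ k)⁻¹ := by
      rw [← hXY]; field_simp
    have := qPoch_pair_quotient hq hx (div_ne_zero hX hy) (N i) k
      (qPoch_ne_zero fun j _ => hdenXY i _ (by simp) j)
      (qPoch_ne_zero fun j _ => by rw [← dxy]; exact hdenXY i _ (by simp) j)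
      (qPoch_ne_zero fun j _ => by rw [← dxy]; exact hdenXY i _ (by simp) j)
      (qPoch_ne_zero fun j _ => by rw [← y1]; exact hdenXY i _ (by simp) j)
    rw [y1, y2, dxy, show (q ^ k)⁻¹ * X i / y = X i / y * (q ^ k)⁻¹ by ring, this, zpow_neg,
      zpow_natCast]
  have hexp : ((2 * n + 3) * k ^ 2 + (2 * n + 1) * k) / 2
      = k * (k + 1) * n + k ^ 2 + k * (k + 1) / 2 := by
    rw [show (2 * n + 3) * k ^ 2 + (2 * n + 1) * k
      = k * (k + 1) + (k * (k + 1) * n + k ^ 2) * 2 by ring, Nat.add_mul_div_right _ _ two_pos]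
    ring
  have hpow : (q / x) ^ (2 * (k : ℤ)) * q ^ (2 * (k : ℤ) ^ 2 - k)
      = (q ^ (k * (k + 1) / 2)) ^ 2 * q ^ k ^ 2 * ((x ^ k) ^ 2)⁻¹ := by
    have e1 : (q / x) ^ (2 * (k : ℤ)) = q ^ (2 * (k : ℤ)) * ((x ^ k) ^ 2)⁻¹ := by
      rw [div_zpow, div_eq_mul_inv, ← pow_mul, ← zpow_natCast x]
      congr 3; push_cast; ring
    rw [e1, sq_pow_triangle, mul_right_comm, ← zpow_add₀ hq, ← pow_add, ← pow_add,
      show 2 * (k : ℤ) + (2 * (k : ℤ) ^ 2 - k) = ((k ^ 2 + k + k ^ 2 : ℕ) : ℤ) by push_cast; ring,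
      zpow_natCast]
  have hz : q ^ (2 * (k : ℤ)) = q ^ (2 * k) := by
    rw [← zpow_natCast]; push_cast; rfl
  have hprod : (∏ i, qPoch q ((q ^ k)⁻¹ * X i / y) k * qPoch q ((q ^ k)⁻¹ * Y i / y) k)
      / ∏ i, qPoch q (X i / (x * y)) (k + 1) * qPoch q (Y i / (x * y)) (k + 1)
      = (∏ i, -(X i / y) * q ^ N i
          / (qPoch q (X i / y) (N i + 1) * qPoch q (X i / (x * y)) (N i + 1)))
        * (∏ i, (qPoch q (X i / y * q ^ (-(k : ℤ))) (N i)
          * qPoch q (q / x * (X i / y) * q ^ (k : ℤ)) (N i)))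
        * (x ^ k * (q ^ (k * (k + 1)))⁻¹) ^ n := by
    rw [← Finset.prod_div_distrib, Finset.prod_congr rfl fun i _ => fi i, Finset.prod_mul_distrib,
      Finset.prod_mul_distrib (f := fun i => -(X i / y) * q ^ N i
          / (qPoch q (X i / y) (N i + 1) * qPoch q (X i / (x * y)) (N i + 1)))]
    simp
  simp only [firstTerm, qPochs, List.map_cons, List.map_nil, List.prod_cons, List.prod_nil,
    mul_one, psiSummand, bilateralConst, psiTerm, hexp, hpow, hz]
  have regroup : ∀ u₀ u₁ u₂ u₃ v₀ v₁ v₂ v₃ P Q : ℂ,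
      u₀ * (u₁ * (u₂ * u₃)) * P / (v₀ * (v₁ * (v₂ * v₃)) * Q)
        = u₀ / v₀ * (u₁ / v₁) * (u₂ / v₂) * (u₃ / v₃) * (P / Q) := by
    intros; simp only [div_eq_mul_inv, mul_inv]; ring
  rw [regroup, hprod, f1, f2, f3, hr']
  have f0' : qPoch q (x * y * (q ^ k)⁻¹) k * q ^ (k * (k + 1) / 2) / (-(x * y)) ^ k
      / qPoch q y (k + 1) = qPochInf q (x * y * q ^ (-(k : ℤ)))
        * qPochInf q (q / x * (x * y) * q ^ (k : ℤ)) / (qPochInf q (x * y) * qPochInf q y)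
        * (q ^ (k * (k + 1) / 2) / (-(x * y)) ^ k) := by
    rw [← f0]; simp only [div_eq_mul_inv]; ring
  rw [f0']
  -- The powers from reversing `q/(xy)`, from the `n` pairs and from the series itself combine to
  -- the ₆ψ₆ weight `a^{2k} q^{2k²-k}` with `a = q/x`; compare `hpow`.
  have hw : q ^ (k * (k + 1) / 2) / (-(x * y)) ^ k * (x ^ k * (q ^ (k * (k + 1)))⁻¹) ^ n
      * q ^ (k * (k + 1) * n + k ^ 2 + k * (k + 1) / 2) * (-y / x ^ (n + 1)) ^ k
      = (q ^ (k * (k + 1) / 2)) ^ 2 * q ^ k ^ 2 * ((x ^ k) ^ 2)⁻¹ := by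
    have e1 : (-y / x ^ (n + 1)) ^ k = (-(x * y)) ^ k / ((x ^ k) ^ n * (x ^ k) ^ 2) := by
      rw [div_pow, ← pow_mul, ← pow_mul, ← pow_mul, eq_div_iff (by positivity), div_mul_eq_mul_div,
        div_eq_iff (by positivity), ← neg_mul, mul_pow (-x), neg_pow x, neg_pow y]
      ring
    have hne : (-(x * y)) ^ k ≠ 0 := pow_ne_zero _ (neg_ne_zero.2 hxy)
    have hkk : q ^ (k * (k + 1)) ≠ 0 := pow_ne_zero _ hq
    rw [e1, mul_pow, inv_pow, pow_add, pow_add, pow_mul q (k * (k + 1)) n]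
    generalize (-(x * y)) ^ k = δ at *
    generalize q ^ (k * (k + 1)) = z at *
    generalize q ^ (k * (k + 1) / 2) = w at *
    field_simp
  rw [← hw, show q ^ (2 * k + 1) / x = q / x * q ^ (2 * k) by ring]
  simp only [div_eq_mul_inv, mul_inv]
  ring

theorem secondTerm_eq_firstTerm {n : ℕ} {x : ℂ} (hx : x ≠ 0) (q y b c d : ℂ) (X Y : Fin n → ℂ)
    (k : ℕ) : secondTerm q x y b c d X Y k = firstTerm q x⁻¹ (x * y) b c d X Y k := by
  have e1 : x⁻¹ * (x * y) = y := inv_mul_cancel_left₀ hx y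
  have e2 : -x ^ (n + 2) * y = -(x * y) / x⁻¹ ^ (n + 1) := by
    rw [inv_pow, div_inv_eq_mul]; ring
  simp only [secondTerm, firstTerm, e1, e2, div_inv_eq_mul]

theorem psiSummand_neg {n : ℕ} {q x y : ℂ} (hq : q ≠ 0) (hx : x ≠ 0) (hy : y ≠ 0) (b c d : ℂ)
    (X : Fin n → ℂ) (N : Fin n → ℕ) (k : ℤ) :
    psiSummand q x y b c d X N (-(k + 1)) = -x * psiSummand q x⁻¹ (x * y) b c d X N k := by
  have ha : q / x ≠ 0 := div_ne_zero hq hx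
  have e1 : x⁻¹ * (x * y) = y := inv_mul_cancel_left₀ hx y
  have e2 : q / (q / x) = x := by field_simp
  have e3 : q ^ 2 / (q / x) = q / x⁻¹ := by field_simp
  have e4 : q / x * (x * y) / q = y := by field_simp
  have e5 : ∀ b : ℂ, q / x * (b / y) / q = b / (x * y) := by intro b; field_simp
  rw [psiSummand, psiSummand, psiTerm_neg hq ha, e1, e2, e3, e4, e5, e5, e5, mul_assoc (-x)]
  congr 2
  refine Finset.prod_congr rfl fun i _ => ?_
  rw [mul_comm]
  have z : q ^ (-(k + 1)) = q ^ (-k) * q⁻¹ := by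
    rw [← zpow_neg_one, ← zpow_add₀ hq]; congr 1; ring
  have z' : q ^ (-(-(k + 1))) = q ^ k * q := by rw [neg_neg, zpow_add₀ hq, zpow_one]
  congr 2
  · rw [z]; field_simp
  · rw [z']; field_simp

theorem bilateralConst_inv {n : ℕ} {x y : ℂ} (hx : x ≠ 0) (hy : y ≠ 0) (q b c d : ℂ)
    (X : Fin n → ℂ) (N : Fin n → ℕ) :
    x ^ n * bilateralConst q x⁻¹ (x * y) b c d X N = bilateralConst q x y b c d X N := by
  have e1 : x⁻¹ * (x * y) = y := inv_mul_cancel_left₀ hx y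
  have e : ∀ i, x * (-(X i / (x * y)) * q ^ N i
      / (qPoch q (X i / (x * y)) (N i + 1) * qPoch q (X i / y) (N i + 1)))
      = -(X i / y) * q ^ N i
        / (qPoch q (X i / y) (N i + 1) * qPoch q (X i / (x * y)) (N i + 1)) := by
    intro i
    have : x * (X i / (x * y)) = X i / y := by field_simp
    rw [← this]
    simp only [div_eq_mul_inv, mul_inv]; ring
  rw [bilateralConst, bilateralConst, e1, ← Finset.prod_congr rfl fun i _ => e i,
    Finset.prod_mul_distrib, Finset.prod_const, Finset.card_univ, Fintype.card_fin]
  simp only [div_eq_mul_inv, mul_inv]; ring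

/-! ### The explicit product and the conclusion. -/

/-- Each infinite product in `Y` is a finite factorial times one of the infinite products in `X`,
because `Y q^N = x y²/X`. All infinite products cancel, and reversal turns the finite ones into
factorials in `X`. -/
theorem prefactor_pair {q x y X Y : ℂ} {N : ℕ} (hq : q ≠ 0) (hq1 : ‖q‖ < 1) (hx : x ≠ 0)
    (hy : y ≠ 0) (hX : X ≠ 0) (hY : Y ≠ 0) (h : x * y ^ 2 / (X * Y) = q ^ N)
    (h1 : qPochInf q (q / X) ≠ 0) (h2 : qPochInf q (x * y ^ 2 / X) ≠ 0)
    (h3 : qPochInf q (Y / y) ≠ 0) (h4 : qPochInf q (Y / (x * y)) ≠ 0) :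
    -(x * y) * (1 / X * (qPochInf q (q * y / X) * (qPochInf q (q * (x * y) / X)
        * (qPochInf q Y * qPochInf q (q * Y / (x * y ^ 2))))
      / (qPochInf q (q / X) * (qPochInf q (x * y ^ 2 / X)
        * (qPochInf q (Y / y) * qPochInf q (Y / (x * y)))))))
      = -(X / y) * q ^ N / (qPoch q (X / y) (N + 1) * qPoch q (X / (x * y)) (N + 1))
        * (qPoch q X N * qPoch q (q * X / (x * y ^ 2)) N) := by
  have hN : q ^ N ≠ 0 := pow_ne_zero N hq
  have hN1 : q ^ (N + 1) ≠ 0 := pow_ne_zero _ hq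
  have i1 := qPochInf_eq_mul hq1 Y N
  have i2 := qPochInf_eq_mul hq1 (q * Y / (x * y ^ 2)) N
  have i3 := qPochInf_eq_mul hq1 (Y / (x * y)) (N + 1)
  have i4 := qPochInf_eq_mul hq1 (Y / y) (N + 1)
  rw [show Y * q ^ N = x * y ^ 2 / X by rw [← h]; field_simp] at i1
  rw [show q * Y / (x * y ^ 2) * q ^ N = q / X by rw [← h]; field_simp] at i2
  rw [show Y / (x * y) * q ^ (N + 1) = q * y / X by rw [pow_succ, ← h]; field_simp] at i3
  rw [show Y / y * q ^ (N + 1) = q * (x * y) / X by rw [pow_succ, ← h]; field_simp] at i4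
  have r1 := qPoch_reflect hq (a := x * y ^ 2 / X) (by positivity) N
  have r2 := qPoch_reflect hq (a := q / X) (by positivity) N
  have r3 := qPoch_reflect hq (a := q * y / X) (by positivity) (N + 1)
  have r4 := qPoch_reflect hq (a := q * (x * y) / X) (by positivity) (N + 1)
  rw [show x * y ^ 2 / X * (q ^ N)⁻¹ = Y by rw [← h]; field_simp,
    show q / (x * y ^ 2 / X) = q * X / (x * y ^ 2) by field_simp] at r1
  rw [show q / X * (q ^ N)⁻¹ = q * Y / (x * y ^ 2) by rw [← h]; field_simp,
    show q / (q / X) = X by field_simp] at r2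
  rw [show q * y / X * (q ^ (N + 1))⁻¹ = Y / (x * y) by rw [pow_succ, ← h]; field_simp,
    show q / (q * y / X) = X / y by field_simp, pow_triangle_succ] at r3
  rw [show q * (x * y) / X * (q ^ (N + 1))⁻¹ = Y / y by rw [pow_succ, ← h]; field_simp,
    show q / (q * (x * y) / X) = X / (x * y) by field_simp, pow_triangle_succ] at r4
  have hw : q ^ (N * (N + 1) / 2) ≠ 0 := pow_ne_zero _ hq
  have e : x * y * ((-(x * y ^ 2 / X)) ^ N * (-(q / X)) ^ N) * (q ^ (N + 1)) ^ 2
      = X * (X / y) * q ^ N * ((-(q * y / X)) ^ (N + 1) * (-(q * (x * y) / X)) ^ (N + 1)) := by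
    have e1 : (-(x * y ^ 2 / X)) ^ N * (-(q / X)) ^ N * q ^ N
        = (-(q * y / X)) ^ N * (-(q * (x * y) / X)) ^ N := by
      rw [← mul_pow, ← mul_pow, ← mul_pow]; congr 1; field_simp
    have e2 : X * (X / y) * ((-(q * y / X)) * (-(q * (x * y) / X))) = x * y * q ^ 2 := by
      field_simp
    rw [pow_succ (-(q * y / X)), pow_succ (-(q * (x * y) / X)), pow_succ q]
    linear_combination x * y * q ^ N * q ^ 2 * e1
      - q ^ N * ((-(q * y / X)) ^ N * (-(q * (x * y) / X)) ^ N) * e2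
  have n3 : qPoch q (Y / (x * y)) (N + 1) ≠ 0 := fun h0 => h4 (by rw [i3, h0, zero_mul])
  have n4 : qPoch q (Y / y) (N + 1) ≠ 0 := fun h0 => h3 (by rw [i4, h0, zero_mul])
  have n5 : qPochInf q (q * y / X) ≠ 0 := fun h0 => h4 (by rw [i3, h0, mul_zero])
  have n6 : qPochInf q (q * (x * y) / X) ≠ 0 := fun h0 => h3 (by rw [i4, h0, mul_zero])
  have m3 : qPoch q (X / y) (N + 1) ≠ 0 := fun h0 => by
    rw [h0, mul_zero] at r3; exact mul_ne_zero n3 (mul_ne_zero hw hN1) r3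
  have m4 : qPoch q (X / (x * y)) (N + 1) ≠ 0 := fun h0 => by
    rw [h0, mul_zero] at r4; exact mul_ne_zero n4 (mul_ne_zero hw hN1) r4
  have d3 : (-(q * y / X)) ^ (N + 1) ≠ 0 := pow_ne_zero _ (neg_ne_zero.2 (by positivity))
  have d4 : (-(q * (x * y) / X)) ^ (N + 1) ≠ 0 := pow_ne_zero _ (neg_ne_zero.2 (by positivity))
  rw [i1, i2, i3, i4, eq_div_of_mul_eq hw r1, eq_div_of_mul_eq hw r2,
    eq_div_of_mul_eq (mul_ne_zero hw hN1) r3, eq_div_of_mul_eq (mul_ne_zero hw hN1) r4]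
  generalize (-(x * y ^ 2 / X)) ^ N = δ₁ at *
  generalize (-(q / X)) ^ N = δ₂ at *
  generalize (-(q * y / X)) ^ (N + 1) = δ₃ at *
  generalize (-(q * (x * y) / X)) ^ (N + 1) = δ₄ at *
  generalize q ^ (N * (N + 1) / 2) = w at *
  generalize qPoch q (X / y) (N + 1) = p₁ at *
  generalize qPoch q (X / (x * y)) (N + 1) = p₂ at *
  generalize qPoch q (q * X / (x * y ^ 2)) N = p₃ at *
  generalize qPochInf q (q / X) = s₁ at *
  generalize qPochInf q (x * y ^ 2 / X) = s₂ at *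
  generalize qPochInf q (q * y / X) = s₃ at *
  generalize qPochInf q (q * (x * y) / X) = s₄ at *
  generalize q ^ (N + 1) = z at *
  field_simp at e ⊢
  linear_combination -(p₃ * qPoch q X N) * e

theorem prefactor_eq {n : ℕ} {q x y b c d : ℂ} {X Y : Fin n → ℂ} {N : Fin n → ℕ}
    (hq : q ≠ 0) (hq1 : ‖q‖ < 1) (hx : x ≠ 0) (hy : y ≠ 0)
    (hXY : ∀ i, x * y ^ 2 / (X i * Y i) = q ^ N i)
    (hdenXY : ∀ i, ∀ u ∈ [Y i / y, Y i / (x * y), q / X i, x * y ^ 2 / X i],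
      ∀ j : ℕ, 1 - u * q ^ j ≠ 0) :
    prefactor q x y b c d X Y
      = bilateralConst q x y b c d X N * psiConst q x (x * y ^ 2) b c d X N := by
  have hp : ∀ i, -(x * y) * (1 / X i * (qPochInf q (q * y / X i) * (qPochInf q (q * (x * y) / X i)
        * (qPochInf q (Y i) * qPochInf q (q * Y i / (x * y ^ 2))))
      / (qPochInf q (q / X i) * (qPochInf q (x * y ^ 2 / X i)
        * (qPochInf q (Y i / y) * qPochInf q (Y i / (x * y)))))))
      = -(X i / y) * q ^ N i / (qPoch q (X i / y) (N i + 1) * qPoch q (X i / (x * y)) (N i + 1))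
        * (qPoch q (X i) (N i) * qPoch q (q * X i / (x * y ^ 2)) (N i)) := by
    intro i
    have hXYi : X i * Y i ≠ 0 := by
      intro h0; have := hXY i; rw [h0, div_zero] at this; exact pow_ne_zero _ hq this.symm
    exact prefactor_pair hq hq1 hx hy (left_ne_zero_of_mul hXYi) (right_ne_zero_of_mul hXYi)
      (hXY i) (qPochInf_ne_zero hq1 (hdenXY i _ (by simp)))
      (qPochInf_ne_zero hq1 (hdenXY i _ (by simp))) (qPochInf_ne_zero hq1 (hdenXY i _ (by simp)))
      (qPochInf_ne_zero hq1 (hdenXY i _ (by simp)))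
  have hprod := Finset.prod_congr (rfl : (Finset.univ : Finset (Fin n)) = _) fun i _ => hp i
  rw [Finset.prod_mul_distrib, Finset.prod_const, Finset.card_univ, Fintype.card_fin,
    Finset.prod_mul_distrib (f := fun i => -(X i / y) * q ^ N i
      / (qPoch q (X i / y) (N i + 1) * qPoch q (X i / (x * y)) (N i + 1)))] at hprod
  simp only [prefactor, qPochInfs, List.map_cons, List.map_nil, List.prod_cons, List.prod_nil,
    mul_one, bilateralConst, psiConst]
  rw [mul_right_comm, hprod]
  simp only [div_eq_mul_inv, mul_inv]
  ring

theorem theorem2p7 (n : ℕ) (q x y b c d : ℂ) (X Y : Fin n → ℂ) (N : Fin n → ℕ)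
    (hq0 : q ≠ 0) (hq1 : ‖q‖ < 1)
    (hx : x ≠ 0) (hy : y ≠ 0) (hb : b ≠ 0) (hc : c ≠ 0) (hd : d ≠ 0)
    (hXY : ∀ i, x * y ^ 2 / (X i * Y i) = q ^ N i)
    (hconv : ‖b * c * d / (x * y ^ 2 * q ^ ((∑ i, N i) + 1))‖ < 1)
    -- the factors in the denominators of the two series and of the infinite products do not vanish
    (hden : ∀ u ∈ [y, x * y, b / y, c / y, d / y, b / (x * y), c / (x * y), d / (x * y)],
      ∀ j : ℕ, 1 - u * q ^ j ≠ 0)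
    (hdenXY : ∀ i, ∀ u ∈ [X i / y, Y i / y, X i / (x * y), Y i / (x * y),
      q / X i, x * y ^ 2 / X i], ∀ j : ℕ, 1 - u * q ^ j ≠ 0)
    -- the denominators of the multiple sum do not vanish at the terms with all `m_s ≤ N_s`
    -- (the other terms are zero, because `(q^{-N_s}; q)_{m_s} = 0` for `m_s > N_s`)
    (hdenM : ∀ s, ∀ u ∈ [q * X s / (x * y ^ 2), q * Y s / (x * y ^ 2)],
      ∀ j < partialSum N s, 1 - u * q ^ j ≠ 0) :
    Summable (firstTerm q x y b c d X Y) ∧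
    Summable (secondTerm q x y b c d X Y) ∧
    (Function.support (multiTerm q x y b c d X Y)).Finite ∧
    (∑' k, firstTerm q x y b c d X Y k) - x ^ (n + 1) * (∑' k, secondTerm q x y b c d X Y k)
      = prefactor q x y b c d X Y * ∑' m : Fin n → ℕ, multiTerm q x y b c d X Y m := by
  have hS := hasSum_psiSummand hq0 hq1 hx hy hb hc hd hXY hconv hdenM
  obtain ⟨hs1, hs2⟩ := summable_int_iff_summable_nat_and_neg_add_zero.1 hS.summable
  have hxy : x * y ≠ 0 := mul_ne_zero hx hy
  have e1 : x⁻¹ * (x * y) = y := inv_mul_cancel_left₀ hx y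
  have h1 : firstTerm q x y b c d X Y
      = fun k : ℕ => bilateralConst q x y b c d X N * psiSummand q x y b c d X N k :=
    funext fun k => firstTerm_eq hq0 hq1 hx hy hXY hden
      (fun i u hu => hdenXY i u (by simp only [List.mem_cons, List.not_mem_nil] at hu ⊢; tauto)) k
  -- Here `x^n` is absorbed by `bilateralConst_inv`, and the last factor `x` together with the minus
  -- sign comes from `psiSummand_neg`.
  have h2 : ∀ k : ℕ, x ^ (n + 1) * secondTerm q x y b c d X Y k
      = -(bilateralConst q x y b c d X N * psiSummand q x y b c d X N (-(k + 1))) := by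
    intro k
    rw [secondTerm_eq_firstTerm hx, firstTerm_eq (N := N) hq0 hq1 (inv_ne_zero hx) hxy
      (fun i => by rw [← hXY i]; field_simp)
      (fun u hu => hden u (by
        rw [e1] at hu; simp only [List.mem_cons, List.not_mem_nil] at hu ⊢; tauto))
      (fun i u hu => hdenXY i u (by
        rw [e1] at hu; simp only [List.mem_cons, List.not_mem_nil] at hu ⊢; tauto)) k,
      psiSummand_neg hq0 hx hy, ← bilateralConst_inv hx hy]
    ring
  have hxn : x ^ (n + 1) ≠ 0 := pow_ne_zero _ hx
  have hs2' : Summable fun k : ℕ => x ^ (n + 1) * secondTerm q x y b c d X Y k := by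
    simp only [h2]
    exact (hs2.mul_left _).neg
  refine ⟨?_, (summable_mul_left_iff hxn).1 hs2',
    finite_support_multiTerm hq0 b c d hXY, ?_⟩
  · rw [h1]; exact hs1.mul_left _
  · rw [← tsum_mul_left, tsum_congr h2, tsum_neg, tsum_mul_left, h1, tsum_mul_left, sub_neg_eq_add,
      ← mul_add, ← tsum_of_nat_of_neg_add_one hs1 hs2, hS.tsum_eq,
      prefactor_eq (N := N) hq0 hq1 hx hy hXY
        (fun i u hu => hdenXY i u (by simp only [List.mem_cons, List.not_mem_nil] at hu ⊢; tauto))]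
    ring
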